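/- **Setting.** Fix $\beta\in\{1,2,4\}$ and a measurable $V:\mathbb R\to\mathbb R$ such that for every $N\ge 1$ all moments of $e^{-NV(x)}dx$ are finite. Put $w_\beta^{(N)}=e^{-NV}$ for $\beta=1,2$ and $w_4^{(N)}=e^{-2NV}$. Let $\tilde\lambda_1\le\dots\le\tilde\lambda_N$ be the ordered eigenvalues of the associated invariant ensemble, i.e. random points with joint density $$R_{N,N}^{(\beta)}(\tilde\lambda)=\frac1{Z_{N,\beta}}\prod_{j<k}|\tilde\lambda_k-\tilde\lambda_j|^\beta\prod_{j=1}^N w_\beta^{(N)}(\tilde\lambda_j)$$ on $\{\tilde\lambda_1\le\dots\le\tilde\lambda_N\}$, where $Z_{N,\beta}$ makes this a probability density there; $R^{(\beta)}_{N,N}$ is regarded as a function on $\mathbb R^N$ by the same formula, and $\mathbb E_{N,\beta}$ denotes expectation. Let $\psi\ge0$ be integrable on $\mathbb R$ with $\frac1N\mathbb E_{N,\beta}\big(\#\{j:\tilde\lambda_j\le s\}\big)\to\int_{-\infty}^s\psi(t)\,dt$ as $N\to\infty$, for all $s\ge0$. Let $a$ be a point of continuity of $\psi$ in the interior of the support of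 $\psi$ with $\psi(a)>0$. Let $I_N=[a-\delta_N,a+\delta_N]$ with $\delta_N>0$, $\delta_N\to0$, $N\delta_N\to\infty$. Put $\lambda_i=(\tilde\lambda_i-a)N\psi(a)$, $A_N=N\psi(a)(I_N-a)$, $|A_N|=2N\psi(a)\delta_N$, and $\tilde t=a+\frac{t}{N\psi(a)}$ for $t\in\mathbb R$. For $1\le k\le N$ let $$B_{N,k}^{(\beta)}(t_1,\dots,t_k)=\frac{(N\psi(a))^{-k}}{(N-k)!}\int_{\mathbb R^{N-k}}R_{N,N}^{(\beta)}(\tilde t_1,\dots,\tilde t_k,y_{k+1},\dots,y_N)\,dy,$$ and define $$\sigma_N=\frac1{|A_N|}\sum_{i:\ \tilde\lambda_i,\tilde\lambda_{i+1}\in I_N}\delta_{\lambda_{i+1}-\lambda_i},\qquad \gamma_N(k)=\frac1{|A_N|}\sum_{\substack{i_1<\dots<i_k\\ \lambda_{i_1},\lambda_{i_k}\in A_N}}\delta_{\lambda_{i_k}-\lambda_{i_1}}\quad(k\ge2).$$ Integrals $\int_0^s$ with respect to these measures are over $[0,s]$. **Limiting kernels.** Let $K_2(x,y)=\frac{\sin\pi(x-y)}{\pi(x-y)}$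 (with $K_2(x,x)=1$), and for $\beta=1,4$ let $K_\beta=\begin{pmatrix}S_\beta&D_\beta\\ I_\beta&S_\beta\end{pmatrix}$ with $$S_1(x,y)=K_2(x,y),\quad D_1(x,y)=\partial_xK_2(x,y),\quad I_1(x,y)=\int_0^{x-y}K_2(t,0)\,dt-\tfrac12\operatorname{sgn}(x-y),$$ $$S_4(x,y)=K_2(2x,2y),\quad D_4(x,y)=\partial_x\big[K_2(2x,2y)\big],\quad I_4(x,y)=\int_0^{x-y}K_2(2t,0)\,dt.$$ **Assumption (uniform kernel convergence).** $\kappa_N\to0$ is a real sequence, and for every $N\geq 1$ there is a kernel $\hat K_{N,\beta}$ (real valued if $\beta=2$, with values in $\mathbb R^{2\times2}$ if $\beta=1,4$) such that for all $1\le k\le N$ and $t\in\mathbb R^k$ $$B^{(2)}_{N,k}(t)=\det\big(\hat K_{N,2}(\tilde t_i,\tilde t_j)\big)_{1\le i,j\le k},\qquad B^{(\beta)}_{N,k}(t)=\operatorname{Pf}\big((\hat K_{N,\beta}(\tilde t_i,\tilde t_j))_{1\le i,j\le k}\,J\big)\quad(\beta=1,4),$$ where $J=\operatorname{diag}(\sigma,\dots,\sigma)\in\mathbb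 R^{2k\times 2k}$, $\sigma=\begin{pmatrix}0&1\\-1&0\end{pmatrix}$, and the matrix under the Pfaffian $\operatorname{Pf}$ is skew-symmetric; and there is a constant $M$ such that for all $N\ge1$ and $x,y\in A_N$ every entry of $\hat K_{N,\beta}(\tilde x,\tilde y)-K_\beta(x,y)$ is at most $M|\kappa_N|$ in absolute value. **Theorem.** Under this assumption the limits $W_k^{(\beta)}(t)=\lim_{N\to\infty}B_{N,k}^{(\beta)}(t)$ exist for all $k\ge1$ and $t\in\mathbb R^k$, with $W^{(2)}_k(t)=\det(K_2(t_i,t_j))_{1\le i,j\le k}$ and $W_k^{(\beta)}(t)=\operatorname{Pf}\big((K_\beta(t_i,t_j))_{1\le i,j\le k}\,J\big)$ for $\beta=1,4$, and: (i) there is a constant $C>0$, not depending on $N$, $k$ and $s$, such that for all integers $2\le k\le N$ and all $s\ge0$ $$\Big|\mathbb E_{N,\beta}\Big(\int_0^sd\gamma_N(k)\Big)-\int_{0\le z_2\le\dots\le z_k\le s}W_k^{(\beta)}(0,z_2,\dots,z_k)\,dz_2\cdots dz_k\Big|\le\frac{s^k\,C^k\,k^{k/2}}{(k-1)!\,|A_N|}+s^{k-1}C^k|\kappa_N|;$$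 (ii) for every $s\ge0$ $$\lim_{N\to\infty}\mathbb E_{N,\beta}\Big(\int_0^sd\sigma_N\Big)=\sum_{k\ge2}(-1)^k\int_{0\le z_2\le\dots\le z_k\le s}W_k^{(\beta)}(0,z_2,\dots,z_k)\,dz_2\cdots dz_k,$$ where the series on the right converges absolutely. -/

import Mathlib

open MeasureTheory Filter Topology

noncomputable section

/-- The symmetry index `β`, which takes the values 1 (orthogonal), 2 (unitary), 4 (symplectic). -/
inductive DysonIndex
  | one
  | two
  | four

/-- The numerical value of `β`. -/
def DysonIndex.val : DysonIndex → ℕ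
  | .one => 1
  | .two => 2
  | .four => 4

/-! ### The ensemble -/

/-- The weight: `exp (-N V x)` for `β = 1, 2` and `exp (-2 N V x)` for `β = 4`. -/
def ensembleWeight (β : DysonIndex) (V : ℝ → ℝ) (N : ℕ) (x : ℝ) : ℝ :=
  match β with
  | .one => Real.exp (-(N * V x))
  | .two => Real.exp (-(N * V x))
  | .four => Real.exp (-(2 * N * V x))

/-- `∏_{j<k} |x_k - x_j|^β ∏_j w(x_j)`. -/
def unnormalizedDensity (β : DysonIndex) (V : ℝ → ℝ) (N : ℕ) (x : Fin N → ℝ) : ℝ :=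
  (∏ j, ∏ k ∈ Finset.Ioi j, |x k - x j| ^ β.val) * ∏ j, ensembleWeight β V N (x j)

/-- Ordered vectors `x_1 ≤ ... ≤ x_N`. -/
def weylChamber (N : ℕ) : Set (Fin N → ℝ) := {x | Monotone x}

/-- The normalization constant, for the density on the Weyl chamber. -/
def partitionConstant (β : DysonIndex) (V : ℝ → ℝ) (N : ℕ) : ℝ :=
  ∫ x in weylChamber N, unnormalizedDensity β V N x

/-- The joint eigenvalue density, as a (symmetric) function on all of `ℝ^N`. -/
def jointDensity (β : DysonIndex) (V : ℝ → ℝ) (N : ℕ) (x : Fin N → ℝ) : ℝ :=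
  (partitionConstant β V N)⁻¹ * unnormalizedDensity β V N x

/-- The law of the ordered eigenvalues. -/
def eigenvalueLaw (β : DysonIndex) (V : ℝ → ℝ) (N : ℕ) : Measure (Fin N → ℝ) :=
  (volume.restrict (weylChamber N)).withDensity
    (fun x => ENNReal.ofReal (jointDensity β V N x))

/-- All moments of `exp (-N V x) dx` are finite, for every `N ≥ 1`. -/
def HasFiniteMoments (V : ℝ → ℝ) : Prop :=
  ∀ N : ℕ, 1 ≤ N → ∀ m : ℕ, Integrable (fun x : ℝ => x ^ m * Real.exp (-(N * V x)))

open Classical in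
/-- `ψ` is a limiting spectral density: the expected proportion of eigenvalues that are at most `s`
tends to `∫_{-∞}^s ψ`. -/
def IsLimitingSpectralDensity (β : DysonIndex) (V ψ : ℝ → ℝ) : Prop :=
  (∀ x, 0 ≤ ψ x) ∧ Integrable ψ ∧
  ∀ s : ℝ, 0 ≤ s →
    Tendsto
      (fun N : ℕ => (1 / (N : ℝ)) *
        ∫ x, ((Finset.univ.filter (fun j => x j ≤ s)).card : ℝ) ∂(eigenvalueLaw β V N))
      atTop (𝓝 (∫ t in Set.Iic s, ψ t))

/-! ### Rescaling. Below, `ρ` stands for `ψ(a)`. -/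

/-- From an eigenvalue to the rescaled eigenvalue. -/
def rescale (ρ a : ℝ) (N : ℕ) (x : ℝ) : ℝ := (x - a) * (N * ρ)

/-- From a rescaled eigenvalue back to the eigenvalue. -/
def unscale (ρ a : ℝ) (N : ℕ) (x : ℝ) : ℝ := a + x / (N * ρ)

/-- The observation window `I_N = [a - δ_N, a + δ_N]`. -/
def window (a : ℝ) (δ : ℕ → ℝ) (N : ℕ) : Set ℝ := Set.Icc (a - δ N) (a + δ N)

/-- The rescaled window `A_N`. -/
def rescaledWindow (ρ a : ℝ) (δ : ℕ → ℝ) (N : ℕ) : Set ℝ := rescale ρ a N '' window a δ N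

/-- The length `|A_N|`. -/
def windowLength (ρ a : ℝ) (δ : ℕ → ℝ) (N : ℕ) : ℝ := volume.real (rescaledWindow ρ a δ N)

/-! ### Spacing measures -/

open Classical in
/-- The empirical spacing measure of the ordered eigenvalues `x`. -/
def spacingMeasure (ρ a : ℝ) (δ : ℕ → ℝ) (N : ℕ) (x : Fin N → ℝ) : Measure ℝ :=
  ENNReal.ofReal (1 / windowLength ρ a δ N) •
    ∑ p ∈ (Finset.univ : Finset (Fin N × Fin N)).filter
        (fun p => (p.2 : ℕ) = p.1 + 1 ∧ x p.2 ∈ window a δ N ∧ x p.1 ∈ window a δ N),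
      Measure.dirac (rescale ρ a N (x p.2) - rescale ρ a N (x p.1))

open Classical in
/-- The counting measure `γ_N(k, ·)`: each `i_1 < ... < i_k` for which the rescaled eigenvalues
number `i_1` and `i_k` lie in `A_N` contributes a point mass at their difference. -/
def clusterMeasure (ρ a : ℝ) (δ : ℕ → ℝ) (N : ℕ) : (k : ℕ) → (x : Fin N → ℝ) → Measure ℝ
  | 0, _ => 0
  | n + 1, x =>
    ENNReal.ofReal (1 / windowLength ρ a δ N) •
      ∑ i ∈ (Finset.univ : Finset (Fin (n + 1) → Fin N)).filter
          (fun i => StrictMono i ∧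
            rescale ρ a N (x (i 0)) ∈ rescaledWindow ρ a δ N ∧
            rescale ρ a N (x (i (Fin.last n))) ∈ rescaledWindow ρ a δ N),
        Measure.dirac (rescale ρ a N (x (i (Fin.last n))) - rescale ρ a N (x (i 0)))

/-- The expected empirical spacing distribution function. -/
def expectedSpacing (β : DysonIndex) (V : ℝ → ℝ) (ρ a : ℝ) (δ : ℕ → ℝ) (N : ℕ) (s : ℝ) : ℝ :=
  ∫ x, (spacingMeasure ρ a δ N x).real (Set.Icc 0 s) ∂(eigenvalueLaw β V N)

/-- The expectation of `∫_0^s dγ_N(k, ·)`. -/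
def expectedCluster (β : DysonIndex) (V : ℝ → ℝ) (ρ a : ℝ) (δ : ℕ → ℝ) (N k : ℕ) (s : ℝ) : ℝ :=
  ∫ x, (clusterMeasure ρ a δ N k x).real (Set.Icc 0 s) ∂(eigenvalueLaw β V N)

/-! ### Correlation functions -/

/-- The vector of length `N` that starts with `x` and continues with `y`. -/
def joinVec {N k : ℕ} (x : Fin k → ℝ) (y : Fin (N - k) → ℝ) : Fin N → ℝ :=
  fun i => if h : (i : ℕ) < k then x ⟨i, h⟩ else y ⟨i - k, by omega⟩

/-- The correlation function `R_{N,k}` (for `k ≤ N`). -/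
def correlation (β : DysonIndex) (V : ℝ → ℝ) (N k : ℕ) (x : Fin k → ℝ) : ℝ :=
  1 / ((N - k).factorial : ℝ) * ∫ y : Fin (N - k) → ℝ, jointDensity β V N (joinVec x y)

/-- The rescaled correlation function `B_{N,k}` (for `k ≤ N`). -/
def rescaledCorrelation (β : DysonIndex) (V : ℝ → ℝ) (ρ a : ℝ) (N k : ℕ) (t : Fin k → ℝ) : ℝ :=
  ((N * ρ) ^ k)⁻¹ * correlation β V N k (fun i => unscale ρ a N (t i))

/-! ### Determinants and Pfaffians of kernels -/

/-- The Pfaffian `(2^k k!)⁻¹ ∑_σ sgn σ ∏_i A_{σ(2i-1), σ(2i)}` of a skew-symmetric `2k × 2k` matrix;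
the `2k` indices are written as pairs in `Fin k × Fin 2`, in lexicographic order, so that the
consecutive indices `2i-1, 2i` are `(i, 0), (i, 1)`. -/
def pfaffian {k : ℕ} (A : Matrix (Fin k × Fin 2) (Fin k × Fin 2) ℝ) : ℝ :=
  1 / (2 ^ k * (k.factorial : ℝ)) *
    ∑ σ : Equiv.Perm (Fin k × Fin 2),
      ((Equiv.Perm.sign σ : ℤ) : ℝ) * ∏ i : Fin k, A (σ (i, 0)) (σ (i, 1))

/-- The `2k × 2k` matrix with the `2 × 2` blocks `K (t_i) (t_j)`. -/
def blockKernel (K : ℝ → ℝ → Matrix (Fin 2) (Fin 2) ℝ) {k : ℕ} (t : Fin k → ℝ) :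
    Matrix (Fin k × Fin 2) (Fin k × Fin 2) ℝ :=
  Matrix.of fun p q => K (t p.1) (t q.1) p.2 q.2

/-- `J = diag(σ, ..., σ)` with `σ = (0, 1; -1, 0)`. -/
def blockJ (k : ℕ) : Matrix (Fin k × Fin 2) (Fin k × Fin 2) ℝ :=
  Matrix.of fun p q => if p.1 = q.1 then !![(0 : ℝ), 1; -1, 0] p.2 q.2 else 0

/-- `K` (in the unrescaled variables) is a kernel for the determinantal representation of the
rescaled correlation functions of the `N`-point ensemble. -/
def IsDeterminantalKernel (β : DysonIndex) (V : ℝ → ℝ) (ρ a : ℝ) (N : ℕ) (K : ℝ → ℝ → ℝ) : Prop :=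
  ∀ k : ℕ, 1 ≤ k → k ≤ N → ∀ t : Fin k → ℝ,
    rescaledCorrelation β V ρ a N k t =
      (Matrix.of fun i j => K (unscale ρ a N (t i)) (unscale ρ a N (t j))).det

/-- `K` (in the unrescaled variables) is a matrix kernel for the Pfaffian representation of the
rescaled correlation functions of the `N`-point ensemble. -/
def IsPfaffianKernel (β : DysonIndex) (V : ℝ → ℝ) (ρ a : ℝ) (N : ℕ)
    (K : ℝ → ℝ → Matrix (Fin 2) (Fin 2) ℝ) : Prop :=
  ∀ k : ℕ, 1 ≤ k → k ≤ N → ∀ t : Fin k → ℝ,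
    let A := blockKernel K (fun i => unscale ρ a N (t i)) * blockJ k
    A.transpose = -A ∧ rescaledCorrelation β V ρ a N k t = pfaffian A

/-! ### Limiting kernels and limiting correlation functions -/

/-- The sine kernel `sin (π (x - y)) / (π (x - y))`, with value 1 on the diagonal. -/
def sineKernel (x y : ℝ) : ℝ := Real.sinc (Real.pi * (x - y))

/-- The limiting matrix kernel for `β = 1`. -/
def limitKernelOne (x y : ℝ) : Matrix (Fin 2) (Fin 2) ℝ :=
  !![sineKernel x y, deriv (fun u => sineKernel u y) x;
     (∫ t in (0 : ℝ)..(x - y), sineKernel t 0) - 1 / 2 * Real.sign (x - y), sineKernel x y]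

/-- The limiting matrix kernel for `β = 4`. -/
def limitKernelFour (x y : ℝ) : Matrix (Fin 2) (Fin 2) ℝ :=
  !![sineKernel (2 * x) (2 * y), deriv (fun u => sineKernel (2 * u) (2 * y)) x;
     ∫ t in (0 : ℝ)..(x - y), sineKernel (2 * t) 0, sineKernel (2 * x) (2 * y)]

/-- The limiting correlation function `W_k`. -/
def limitCorrelation (β : DysonIndex) (k : ℕ) (t : Fin k → ℝ) : ℝ :=
  match β with
  | .one => pfaffian (blockKernel limitKernelOne t * blockJ k)
  | .two => (Matrix.of fun i j => sineKernel (t i) (t j)).det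
  | .four => pfaffian (blockKernel limitKernelFour t * blockJ k)

/-- The integral of `W_k (0, z_2, ..., z_k)` over `0 ≤ z_2 ≤ ... ≤ z_k ≤ s` (for `k ≥ 1`). -/
def orderedIntegral (β : DysonIndex) : (k : ℕ) → (s : ℝ) → ℝ
  | 0, _ => 0
  | n + 1, s =>
    ∫ z in {z : Fin n → ℝ | Monotone z ∧ ∀ i, 0 ≤ z i ∧ z i ≤ s},
      limitCorrelation β (n + 1) (Fin.cons 0 z)

/-! ### The assumption of uniform kernel convergence -/

/-- Uniform convergence on the windows `A_N`, with error `O(κ_N)`, of some Pfaffian matrix kernels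
to the matrix kernel `L`. -/
def PfaffianKernelsConverge (β : DysonIndex) (V : ℝ → ℝ) (ρ a : ℝ) (δ κ : ℕ → ℝ)
    (L : ℝ → ℝ → Matrix (Fin 2) (Fin 2) ℝ) : Prop :=
  ∃ K : ℕ → ℝ → ℝ → Matrix (Fin 2) (Fin 2) ℝ,
    (∀ N : ℕ, 1 ≤ N → IsPfaffianKernel β V ρ a N (K N)) ∧
    ∃ M : ℝ, ∀ N : ℕ, 1 ≤ N →
      ∀ x ∈ rescaledWindow ρ a δ N, ∀ y ∈ rescaledWindow ρ a δ N, ∀ i j : Fin 2,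
        |K N (unscale ρ a N x) (unscale ρ a N y) i j - L x y i j| ≤ M * |κ N|

/-- Uniform convergence on the windows `A_N`, with error `O(κ_N)`, of some determinantal kernels
to the kernel `L`. -/
def DeterminantalKernelsConverge (β : DysonIndex) (V : ℝ → ℝ) (ρ a : ℝ) (δ κ : ℕ → ℝ)
    (L : ℝ → ℝ → ℝ) : Prop :=
  ∃ K : ℕ → ℝ → ℝ → ℝ,
    (∀ N : ℕ, 1 ≤ N → IsDeterminantalKernel β V ρ a N (K N)) ∧
    ∃ M : ℝ, ∀ N : ℕ, 1 ≤ N →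
      ∀ x ∈ rescaledWindow ρ a δ N, ∀ y ∈ rescaledWindow ρ a δ N,
        |K N (unscale ρ a N x) (unscale ρ a N y) - L x y| ≤ M * |κ N|

/-- The kernels of the rescaled correlation functions converge to the limiting kernel, uniformly
on the windows `A_N` with error `O(κ_N)`. -/
def KernelsConverge (β : DysonIndex) (V : ℝ → ℝ) (ρ a : ℝ) (δ κ : ℕ → ℝ) : Prop :=
  match β with
  | .one => PfaffianKernelsConverge .one V ρ a δ κ limitKernelOne
  | .two => DeterminantalKernelsConverge .two V ρ a δ κ sineKernel
  | .four => PfaffianKernelsConverge .four V ρ a δ κ limitKernelFour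

end

/-! Part (i). By symmetry of the joint density, the expectation of a sum over increasing `k`-tuples
of eigenvalues is an integral against `B_{N,k}`. Hence `|A_N| E γ_N(k)([0,s])` is the integral of
`B_{N,k}` over ordered tuples that lie in `A_N` and have diameter at most `s`
(`expectedCluster_eq`). In the coordinates `(t_1, t_2 - t_1, ...)` this region is the product of
`A_N` with an ordered simplex of volume `s^(k-1)/(k-1)!`, except for a layer of width `s` at the
right end of `A_N`. Two errors arise when `B_{N,k}` is replaced by `W_k` and the region by the
product (`abs_expectedCluster_sub_le`). Since `W_k` is translation invariant, the resulting main
term is `|A_N|` times the integral in the statement.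

The replacement of `B_{N,k}` by `W_k` costs at most `C^k (k-1)! |κ_N|`, by comparing the expansions
of determinants or Pfaffians term by term; the volume of the simplex absorbs the factorial. The
boundary layer costs `s` times the supremum of `|W_k|` times the volume of the simplex. Here a
term-by-term bound of order `k!` is too weak: it would give the series in (ii) only a geometric
majorant, useless for large `s`. What is needed is the Hadamard-type bound `|W_k| ≤ C^k k^(k/2)`.
For Pfaffians it is proved without `Pf(A)^2 = det A`: an orthogonal change of basis makes the skew
matrix triangular in blocks, only pair-preserving permutations survive in the Pfaffian, and the
arithmetic-geometric mean inequality finishes (`pfaffian_sq_le_of_abs_le`).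

Part (ii). A pair of points with `d` points between them is counted `d.choose (k - 2)` times by
`γ_N(k)`, and the alternating sum of these numbers is 1 if `d = 0` and 0 otherwise. Truncated
alternating sums therefore bound the number of spacings from below or above according to the parity
of the truncation (Bonferroni). For a fixed truncation (i) gives the limit in `N`; afterwards the
truncation is sent to infinity, which uses only the convergence of the limiting series
(`summable_orderedIntegral`). -/

/-! ### Hadamard-type bounds for determinants and Pfaffians -/

/-- Multilinear expansion, as for the product rule of determinants: each product of entries becomes
a sum over all maps `f` of the index set to itself. Non-injective `f` contribute a determinant with
two equal columns, and a permutation `f` contributes `det P` with the sign of `f`. -/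
theorem pfaffian_conj {k : ℕ} (P A : Matrix (Fin k × Fin 2) (Fin k × Fin 2) ℝ) :
    pfaffian (P * A * P.transpose) = P.det * pfaffian A := by
  have entry : ∀ p q, (P * A * P.transpose) p q = ∑ c : Fin 2 → Fin k × Fin 2,
      P p (c 0) * P q (c 1) * A (c 0) (c 1) := by
    intro p q
    rw [← (finTwoArrowEquiv (Fin k × Fin 2)).symm.sum_comp, Fintype.sum_prod_type_right]
    simp only [Matrix.mul_apply, Matrix.transpose_apply, Finset.sum_mul]
    refine Finset.sum_congr rfl fun b _ => Finset.sum_congr rfl fun a _ => ?_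
    simp
    ring
  have expand : ∀ σ : Equiv.Perm (Fin k × Fin 2),
      ∏ i : Fin k, (P * A * P.transpose) (σ (i, 0)) (σ (i, 1)) =
      ∑ f : Fin k × Fin 2 → Fin k × Fin 2,
        (∏ i, A (f (i, 0)) (f (i, 1))) * ∏ p, P (σ p) (f p) := by
    intro σ
    simp only [entry]
    rw [Finset.prod_univ_sum, Fintype.piFinset_univ,
      ← (Equiv.curry (Fin k) (Fin 2) (Fin k × Fin 2)).sum_comp]
    refine Finset.sum_congr rfl fun f _ => ?_
    rw [Fintype.prod_prod_type, ← Finset.prod_mul_distrib]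
    refine Finset.prod_congr rfl fun i _ => ?_
    simp [Fin.prod_univ_two, Function.curry]
    ring
  unfold pfaffian
  rw [mul_left_comm P.det]
  congr 1
  simp only [expand, Finset.mul_sum]
  rw [Finset.sum_comm]
  -- Summing over `σ` first collects the entries of `P` into the determinant of the matrix whose
  -- columns are the columns of `P` selected by `f`.
  have inner : ∀ f : Fin k × Fin 2 → Fin k × Fin 2,
      ∑ σ : Equiv.Perm (Fin k × Fin 2), ((Equiv.Perm.sign σ : ℤ) : ℝ) *
        ((∏ i, A (f (i, 0)) (f (i, 1))) * ∏ p, P (σ p) (f p)) =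
      (∏ i, A (f (i, 0)) (f (i, 1))) * (P.submatrix id f).det := by
    intro f
    rw [Matrix.det_apply', Finset.mul_sum]
    refine Finset.sum_congr rfl fun σ _ => ?_
    simp only [Matrix.submatrix_apply, id]
    ring
  simp only [inner]
  have inj : ∀ f : Fin k × Fin 2 → Fin k × Fin 2, ¬ Function.Injective f →
      (∏ i, A (f (i, 0)) (f (i, 1))) * (P.submatrix id f).det = 0 := by
    intro f hf
    simp only [Function.Injective, not_forall] at hf
    obtain ⟨i, j, hij, hne⟩ := hf
    rw [Matrix.det_zero_of_column_eq hne (fun l => by simp [hij]), mul_zero]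
  symm
  refine Finset.sum_bij_ne_zero (fun σ _ _ => (σ : Fin k × Fin 2 → Fin k × Fin 2))
    (fun _ _ _ => Finset.mem_univ _) (fun σ _ _ τ _ _ h => DFunLike.coe_injective h) ?_ ?_
  · intro f _ hf
    have hinj : Function.Injective f := by
      by_contra h
      exact hf (inj f h)
    refine ⟨Equiv.ofBijective f (Finite.injective_iff_bijective.1 hinj), Finset.mem_univ _, ?_, rfl⟩
    intro h0
    apply hf
    have := Matrix.det_permute' (Equiv.ofBijective f (Finite.injective_iff_bijective.1 hinj)) P
    simp only [Equiv.ofBijective_apply] at h0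
    have e : (⇑(Equiv.ofBijective f (Finite.injective_iff_bijective.1 hinj))) = f := rfl
    rw [e] at this
    rw [this]
    linear_combination h0
  · intro σ _ _
    rw [Matrix.det_permute']
    ring

/-- A product of nonnegative numbers is at most the power of their mean. -/
theorem prod_le_mean_pow {ι : Type*} [Fintype ι] (x : ι → ℝ) (hx : ∀ i, 0 ≤ x i) :
    ∏ i, x i ≤ ((∑ i, x i) / Fintype.card ι) ^ Fintype.card ι := by
  rcases isEmpty_or_nonempty ι with h | h
  · simp
  have hc : (0 : ℝ) < Fintype.card ι := by exact_mod_cast Fintype.card_pos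
  have := Real.geom_mean_le_arith_mean Finset.univ (fun _ => (1 : ℝ)) x (fun _ _ => zero_le_one)
    (by simp [Fintype.card_pos]) (fun i _ => hx i)
  simp only [Real.rpow_one, Finset.sum_const, Finset.card_univ, nsmul_eq_mul, mul_one,
    one_mul] at this
  have hp : 0 ≤ ∏ i, x i := Finset.prod_nonneg fun i _ => hx i
  calc ∏ i, x i = ((∏ i, x i) ^ ((Fintype.card ι : ℝ)⁻¹)) ^ Fintype.card ι := by
        rw [← Real.rpow_natCast, ← Real.rpow_mul hp, inv_mul_cancel₀ hc.ne', Real.rpow_one]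
    _ ≤ _ := by gcongr

/-- The square of the determinant is the product of the eigenvalues of `A Aᵀ`, and their sum is the
trace, i.e. the sum of the squared entries. The inequality between the means does the rest. -/
theorem Matrix.det_sq_le_of_abs_le {n : ℕ} (A : Matrix (Fin n) (Fin n) ℝ) {c : ℝ}
    (hA : ∀ i j, |A i j| ≤ c) : A.det ^ 2 ≤ (n * c ^ 2) ^ n := by
  have hps := Matrix.posSemidef_self_mul_conjTranspose A
  have hdet : A.det ^ 2 = ∏ i, hps.isHermitian.eigenvalues i := by
    have := hps.isHermitian.det_eq_prod_eigenvalues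
    simp only [Matrix.det_mul, Matrix.conjTranspose_eq_transpose_of_trivial,
      Matrix.det_transpose] at this
    rw [sq, this]; simp
  have htr : ∑ i, hps.isHermitian.eigenvalues i = ∑ i, ∑ j, A i j ^ 2 := by
    have := hps.isHermitian.trace_eq_sum_eigenvalues
    simp only [RCLike.ofReal_real_eq_id, id] at this
    rw [← this]
    simp [Matrix.trace, Matrix.mul_apply, sq]
  rw [hdet]
  refine (prod_le_mean_pow _ hps.eigenvalues_nonneg).trans ?_
  rw [htr, Fintype.card_fin]
  refine pow_le_pow_left₀ (by positivity) ?_ n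
  · refine div_le_of_le_mul₀ (Nat.cast_nonneg _) (by positivity) ?_
    calc ∑ i, ∑ j, A i j ^ 2 ≤ ∑ _i : Fin n, ∑ _j : Fin n, c ^ 2 := by
          refine Finset.sum_le_sum fun i _ => Finset.sum_le_sum fun j _ => ?_
          rw [← sq_abs]
          exact pow_le_pow_left₀ (abs_nonneg _) (hA i j) 2
      _ = _ := by simp; ring

/-- The other index of the pair that contains a given index. -/
def pairSwap {k : ℕ} (p : Fin k × Fin 2) : Fin k × Fin 2 := (p.1, 1 - p.2)

/-- A permutation with a nonzero term matches the indices in couples `σ (i, 0)`, `σ (i, 1)`. By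
strong induction on `j`, the index `(j, 0)` cannot be matched with a later pair, where `D` vanishes,
nor with an earlier one, whose members are already matched with each other. Only `(j, 1)` remains.
-/
theorem fst_apply_eq_of_forall_ne_zero {k : ℕ} (D : Matrix (Fin k × Fin 2) (Fin k × Fin 2) ℝ)
    (h1 : ∀ i j b, i < j → D (i, 0) (j, b) = 0) (h2 : ∀ i j b, i < j → D (j, b) (i, 0) = 0)
    (σ : Equiv.Perm (Fin k × Fin 2)) (hσ : ∀ i, D (σ (i, 0)) (σ (i, 1)) ≠ 0) (i : Fin k) :
    (σ (i, 0)).1 = (σ (i, 1)).1 := by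
  -- The matching as a fixed-point free involution: `π p` is the index that `σ` couples with `p`.
  set π : Fin k × Fin 2 → Fin k × Fin 2 := fun p => σ (pairSwap (σ.symm p)) with hπ
  have hss : ∀ p : Fin k × Fin 2, pairSwap (pairSwap p) = p := fun p => by simp [pairSwap]
  have hππ : ∀ p, π (π p) = p := fun p => by simp [hπ, hss]
  have hne : ∀ p, π p ≠ p := by
    intro p h
    have h' : pairSwap (σ.symm p) = σ.symm p := by
      apply σ.injective; simpa [hπ] using h
    have h3 := congrArg Prod.snd h'
    simp only [pairSwap] at h3
    generalize (σ.symm p).2 = c at h3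
    fin_cases c <;> simp at h3
  have hD : ∀ p, D p (π p) ≠ 0 ∨ D (π p) p ≠ 0 := by
    intro p
    obtain ⟨⟨l, c⟩, rfl⟩ := σ.surjective p
    have := hσ l
    fin_cases c
    · left; simpa [hπ, pairSwap] using this
    · right; simpa [hπ, pairSwap] using this
  have key : ∀ (n : ℕ) (p : Fin k × Fin 2), (p.1 : ℕ) = n → (π p).1 = p.1 := by
    intro n
    induction n using Nat.strong_induction_on with
    | _ n ih =>
      have zero : ∀ j : Fin k, (j : ℕ) = n → π (j, 0) = (j, 1) := by
        intro j hj
        have hle : (π (j, 0)).1 ≤ j := by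
          by_contra hlt
          rw [not_le] at hlt
          rcases hD (j, 0) with h | h
          · exact h (h1 j _ _ hlt)
          · exact h (h2 j _ _ hlt)
        have heq : (π (j, 0)).1 = j := by
          by_contra hcon
          have hlt : (π (j, 0)).1 < j := lt_of_le_of_ne hle hcon
          have := ih _ (by rw [← hj]; exact hlt) (π (j, 0)) rfl
          rw [hππ] at this
          exact hcon this.symm
        have hn := hne (j, 0)
        refine Prod.ext heq ?_
        have : (π (j, 0)).2 ≠ 0 := fun h0 => hn (Prod.ext heq h0)
        generalize (π (j, 0)).2 = c at this
        fin_cases c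
        · exact absurd rfl this
        · rfl
      rintro ⟨j, c⟩ hj
      fin_cases c
      · simpa using congrArg Prod.fst (zero j hj)
      · have : π (j, 1) = (j, 0) := by rw [← zero j hj, hππ]
        simpa using congrArg Prod.fst this
  have := key _ (σ (i, 0)) rfl
  simpa [hπ, pairSwap] using this.symm

/-- The surviving permutations permute the pairs and possibly swap the members of a pair. By
skewness they all contribute the same absolute value, and their number is at most `2 ^ k * k!`,
which cancels the normalization of the Pfaffian. -/
theorem abs_pfaffian_le_prod {k : ℕ} (D : Matrix (Fin k × Fin 2) (Fin k × Fin 2) ℝ)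
    (hD : D.transpose = -D) (h1 : ∀ i j b, i < j → D (i, 0) (j, b) = 0) :
    |pfaffian D| ≤ ∏ i, |D (i, 0) (i, 1)| := by
  classical
  have hskew : ∀ p q, D p q = - D q p := fun p q => by
    have := congrFun (congrFun hD q) p
    simpa using this
  have h2 : ∀ i j b, i < j → D (j, b) (i, 0) = 0 := fun i j b h => by
    rw [hskew, h1 i j b h, neg_zero]
  set G : Finset (Equiv.Perm (Fin k × Fin 2)) :=
    Finset.univ.filter fun σ => ∀ i, D (σ (i, 0)) (σ (i, 1)) ≠ 0 with hG
  have hfst : ∀ σ ∈ G, ∀ i, (σ (i, 0)).1 = (σ (i, 1)).1 := fun σ hσ i =>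
    fst_apply_eq_of_forall_ne_zero D h1 h2 σ (Finset.mem_filter.1 hσ).2 i
  have hsnd : ∀ σ ∈ G, ∀ i, σ (i, 1) = pairSwap (σ (i, 0)) := by
    intro σ hσ i
    have hne : σ (i, 1) ≠ σ (i, 0) := fun h => by simpa using σ.injective h
    have hf := hfst σ hσ i
    refine Prod.ext hf.symm ?_
    have hn : (σ (i, 1)).2 ≠ (σ (i, 0)).2 := fun h => hne (Prod.ext hf.symm h)
    exact (by decide : ∀ c d : Fin 2, c ≠ d → c = 1 - d) _ _ hn
  have hinj : ∀ σ ∈ G, Function.Injective fun i => (σ (i, 0)).1 := by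
    intro σ hσ i j hij
    have h : σ (i, 0) = σ (j, 0) ∨ σ (i, 0) = σ (j, 1) := by
      rw [hsnd σ hσ j]
      replace hij : (σ (i, 0)).1 = (σ (j, 0)).1 := hij
      generalize σ (i, 0) = p at hij ⊢
      generalize σ (j, 0) = q at hij ⊢
      obtain ⟨a, c⟩ := p
      obtain ⟨b, d⟩ := q
      obtain rfl : a = b := hij
      fin_cases c <;> fin_cases d <;> simp [pairSwap]
    rcases h with h | h
    · simpa using σ.injective h
    · simpa using σ.injective h
  have hval : ∀ σ ∈ G, ∏ i, |D (σ (i, 0)) (σ (i, 1))| = ∏ i, |D (i, 0) (i, 1)| := by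
    intro σ hσ
    have hb := Finite.injective_iff_bijective.1 (hinj σ hσ)
    rw [← (Equiv.ofBijective _ hb).prod_comp fun i => |D (i, 0) (i, 1)|]
    refine Finset.prod_congr rfl fun i _ => ?_
    rw [hsnd σ hσ i]
    simp only [Equiv.ofBijective_apply]
    generalize σ (i, 0) = p
    obtain ⟨a, c⟩ := p
    fin_cases c
    · simp [pairSwap]
    · simp [pairSwap]
      rw [hskew, abs_neg]
  -- Such a permutation is determined by its values at the indices `(i, 0)`, that is, by a
  -- permutation of the pairs and a choice of one member in each.
  have hcard : (G.card : ℝ) ≤ 2 ^ k * k.factorial := by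
    have : G.card ≤ ((Finset.univ : Finset (Equiv.Perm (Fin k) × (Fin k → Fin 2))).image
        (fun te => fun i => (te.1 i, te.2 i))).card := by
      refine Finset.card_le_card_of_injOn (fun σ => fun i => σ (i, 0)) ?_ ?_
      · intro σ hσ
        have hb := Finite.injective_iff_bijective.1 (hinj σ hσ)
        simp only [Finset.coe_image, Set.mem_image, Finset.coe_univ, Set.mem_univ, true_and]
        exact ⟨(Equiv.ofBijective _ hb, fun i => (σ (i, 0)).2), rfl⟩
      · intro σ hσ τ hτ h
        ext1 ⟨i, c⟩
        have h0 := congrFun h i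
        simp only at h0
        fin_cases c
        · exact h0
        · simp only [Fin.mk_one]
          rw [hsnd σ hσ, hsnd τ hτ, h0]
    have h' := this.trans Finset.card_image_le
    simp [Fintype.card_perm] at h'
    have : (G.card : ℝ) ≤ ((k.factorial * 2 ^ k : ℕ) : ℝ) := by exact_mod_cast h'
    push_cast at this
    linarith
  unfold pfaffian
  rw [abs_mul, abs_of_nonneg (by positivity : (0 : ℝ) ≤ 1 / (2 ^ k * (k.factorial : ℝ)))]
  have hsum : |∑ σ : Equiv.Perm (Fin k × Fin 2),
      ((Equiv.Perm.sign σ : ℤ) : ℝ) * ∏ i : Fin k, D (σ (i, 0)) (σ (i, 1))| ≤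
      (2 ^ k * k.factorial) * ∏ i, |D (i, 0) (i, 1)| := by
    calc _ ≤ ∑ σ : Equiv.Perm (Fin k × Fin 2),
        |((Equiv.Perm.sign σ : ℤ) : ℝ) * ∏ i : Fin k, D (σ (i, 0)) (σ (i, 1))| :=
          Finset.abs_sum_le_sum_abs _ _
      _ = ∑ σ : Equiv.Perm (Fin k × Fin 2), ∏ i : Fin k, |D (σ (i, 0)) (σ (i, 1))| := by
          refine Finset.sum_congr rfl fun σ _ => ?_
          rw [abs_mul, Finset.abs_prod]
          rcases Int.units_eq_one_or (Equiv.Perm.sign σ) with h | h <;> simp [h]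
      _ = ∑ σ ∈ G, ∏ i : Fin k, |D (σ (i, 0)) (σ (i, 1))| := by
          symm
          refine Finset.sum_subset (Finset.subset_univ _) fun σ _ hσ => ?_
          simp only [hG, Finset.mem_filter, Finset.mem_univ, true_and, not_forall, not_not] at hσ
          obtain ⟨i, hi⟩ := hσ
          exact Finset.prod_eq_zero (Finset.mem_univ i) (by rw [hi, abs_zero])
      _ = G.card * ∏ i, |D (i, 0) (i, 1)| := by
          rw [Finset.sum_congr rfl hval, Finset.sum_const, nsmul_eq_mul]
      _ ≤ _ := by
          refine mul_le_mul_of_nonneg_right hcard (Finset.prod_nonneg fun i _ => abs_nonneg _)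
  calc _ ≤ 1 / (2 ^ k * (k.factorial : ℝ)) * ((2 ^ k * k.factorial) * ∏ i, |D (i, 0) (i, 1)|) := by
        gcongr
    _ = _ := by field_simp

/-! ### Triangular form of a skew-symmetric map -/

section Skew

variable {E : Type*} [NormedAddCommGroup E] [InnerProductSpace ℝ E] [FiniteDimensional ℝ E]

open scoped InnerProductSpace

/-- For a skew-symmetric map, a unit vector `u` of a subspace can be complemented by a unit vector
`w` such that the image of `u` is orthogonal to the orthogonal complement of `u, w`. -/
theorem exists_unit_vectors_of_skew (T : E →ₗ[ℝ] E) (hT : ∀ x, ⟪T x, x⟫_ℝ = 0)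
    (U : Submodule ℝ E) (hU : 2 ≤ Module.finrank ℝ U) :
    ∃ u ∈ U, ∃ w ∈ U, ‖u‖ = 1 ∧ ‖w‖ = 1 ∧ ⟪u, w⟫_ℝ = 0 ∧
      ∀ y ∈ U, ⟪w, y⟫_ℝ = 0 → ⟪T u, y⟫_ℝ = 0 := by
  have hUne : U ≠ ⊥ := by
    rintro rfl
    simp at hU
  obtain ⟨u0, hu0, hu0n⟩ := Submodule.exists_mem_ne_zero_of_ne_bot hUne
  set u : E := (‖u0‖⁻¹ : ℝ) • u0 with hu
  have huU : u ∈ U := U.smul_mem _ hu0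
  have hun : ‖u‖ = 1 := by
    rw [hu, norm_smul, norm_inv, norm_norm, inv_mul_cancel₀ (norm_ne_zero_iff.2 hu0n)]
  have hproj : ∀ y ∈ U, ⟪T u, y⟫_ℝ = ⟪(U.starProjection (T u)), y⟫_ℝ := by
    intro y hy
    have := U.starProjection_inner_eq_zero (T u) y hy
    rw [inner_sub_left] at this
    linarith
  have htU : U.starProjection (T u) ∈ U := U.starProjection_apply_mem _
  set t := U.starProjection (T u) with ht
  have htu : ⟪u, t⟫_ℝ = 0 := by
    rw [real_inner_comm, ← hproj u huU, hT]
  -- Inside `U`, the map `T u` is seen only through its projection `t`, which is orthogonal to `u`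
  -- by skewness. So `w` is `t` normalized, or, if `t = 0`, any unit vector of `U` orthogonal to
  -- `u`.
  by_cases h0 : t = 0
  · have h1 : Module.finrank ℝ (ℝ ∙ u) + Module.finrank ℝ ((ℝ ∙ u)ᗮ ⊓ U : Submodule ℝ E) =
        Module.finrank ℝ U :=
      Submodule.finrank_add_inf_finrank_orthogonal (by
        rw [Submodule.span_singleton_le_iff_mem]; exact huU)
    have hu_ne : u ≠ 0 := fun h => by simp [h] at hun
    rw [finrank_span_singleton hu_ne] at h1
    have hne : ((ℝ ∙ u)ᗮ ⊓ U : Submodule ℝ E) ≠ ⊥ := by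
      intro h
      rw [h] at h1
      simp at h1
      omega
    obtain ⟨w0, hw0, hw0n⟩ := Submodule.exists_mem_ne_zero_of_ne_bot hne
    have hw1 := Submodule.mem_orthogonal_singleton_iff_inner_right.1 hw0.1
    refine ⟨u, huU, (‖w0‖⁻¹ : ℝ) • w0, U.smul_mem _ hw0.2, hun, ?_, ?_, ?_⟩
    · rw [norm_smul, norm_inv, norm_norm, inv_mul_cancel₀ (norm_ne_zero_iff.2 hw0n)]
    · rw [inner_smul_right, hw1, mul_zero]
    · intro y hy _
      rw [hproj y hy, h0, inner_zero_left]
  · refine ⟨u, huU, (‖t‖⁻¹ : ℝ) • t, U.smul_mem _ htU, hun, ?_, ?_, ?_⟩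
    · rw [norm_smul, norm_inv, norm_norm, inv_mul_cancel₀ (norm_ne_zero_iff.2 h0)]
    · rw [inner_smul_right, htu, mul_zero]
    · intro y hy h
      rw [hproj y hy]
      rw [inner_smul_left] at h
      simpa [h0] using h

/-- Split off the plane of `u` and `w` and continue in its orthogonal complement within `U`, whose
dimension is smaller by 2. The plane need not be invariant, since nothing is required of the image
of `w`; this spares the spectral theory behind the block-diagonal normal form. -/
theorem exists_orthonormal_skew_triangular (T : E →ₗ[ℝ] E) (hT : ∀ x, ⟪T x, x⟫_ℝ = 0) (k : ℕ) :
    ∀ U : Submodule ℝ E, Module.finrank ℝ U = 2 * k →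
      ∃ v : Fin k × Fin 2 → E, Orthonormal ℝ v ∧ (∀ p, v p ∈ U) ∧
        ∀ i j b, i < j → ⟪T (v (i, 0)), v (j, b)⟫_ℝ = 0 := by
  induction k with
  | zero =>
    intro U _
    refine ⟨fun _ => 0, ⟨fun p => p.1.elim0, fun p => p.1.elim0⟩, fun p => p.1.elim0,
      fun i => i.elim0⟩
  | succ k ih =>
    intro U hU
    obtain ⟨u, hu, w, hw, hun, hwn, huw, hTu⟩ := exists_unit_vectors_of_skew T hT U (by omega)
    have hon : Orthonormal ℝ ![u, w] := by
      refine ⟨fun i => ?_, fun i j hij => ?_⟩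
      · fin_cases i <;> simpa
      · fin_cases i <;> fin_cases j <;> simp_all [real_inner_comm]
    set S : Submodule ℝ E := Submodule.span ℝ (Set.range ![u, w]) with hS
    have hSU : S ≤ U := by
      rw [hS, Submodule.span_le]
      rintro _ ⟨i, rfl⟩
      fin_cases i <;> simpa
    have hfr := Submodule.finrank_add_inf_finrank_orthogonal hSU
    rw [hS, finrank_span_eq_card hon.linearIndependent, Fintype.card_fin, ← hS] at hfr
    obtain ⟨v, hv, hvU, hvT⟩ := ih (Sᗮ ⊓ U) (by omega)
    have hperp : ∀ b p, ⟪![u, w] b, v p⟫_ℝ = 0 := fun b p =>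
      Submodule.inner_right_of_mem_orthogonal (Submodule.subset_span (Set.mem_range_self b))
        (hvU p).1
    refine ⟨fun p => Fin.cases (![u, w] p.2) (fun i => v (i, p.2)) p.1, ⟨?_, ?_⟩, ?_, ?_⟩
    · rintro ⟨i, b⟩
      cases i using Fin.cases with
      | zero => exact hon.1 b
      | succ i => exact hv.1 (i, b)
    · rintro ⟨i, b⟩ ⟨j, c⟩ hij
      cases i using Fin.cases with
      | zero =>
        cases j using Fin.cases with
        | zero => exact hon.2 (fun h => hij (by rw [h]))
        | succ j => exact hperp b (j, c)
      | succ i =>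
        cases j using Fin.cases with
        | zero => exact (real_inner_comm _ _).trans (hperp c (i, b))
        | succ j => exact hv.2 (fun h => hij (by simpa using h))
    · rintro ⟨i, b⟩
      cases i using Fin.cases with
      | zero => exact hSU (Submodule.subset_span (Set.mem_range_self b))
      | succ i => exact (hvU (i, b)).2
    · intro i j b hij
      cases j using Fin.cases with
      | zero => exact absurd hij (by simp)
      | succ j =>
        cases i using Fin.cases with
        | zero => exact hTu _ (hvU (j, b)).2 (hperp 1 (j, b))
        | succ i => exact hvT i j b (by simpa using hij)

end Skew

/-- A skew-symmetric real matrix can be brought by an orthogonal matrix into a form where the first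
index of each pair is only coupled to its partner and to earlier pairs. -/
theorem exists_orthogonal_conj_triangular {k : ℕ} (A : Matrix (Fin k × Fin 2) (Fin k × Fin 2) ℝ)
    (hA : A.transpose = -A) :
    ∃ P : Matrix (Fin k × Fin 2) (Fin k × Fin 2) ℝ, P * P.transpose = 1 ∧
      ∀ i j b, i < j → (P * A * P.transpose) (i, 0) (j, b) = 0 := by
  -- With the transpose, the form is `xᵀ A y`, which is an entry of `P A Pᵀ` when `x` and `y` are
  -- rows of `P`.
  have hinner : ∀ x y : EuclideanSpace ℝ (Fin k × Fin 2),
      inner ℝ (Matrix.toEuclideanLin A.transpose x) y = ∑ p, ∑ q, x p * A p q * y q := by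
    intro x y
    simp only [PiLp.inner_apply, RCLike.inner_apply, conj_trivial, Matrix.toLpLin_apply,
      Matrix.mulVec, dotProduct, Matrix.transpose_apply, Finset.mul_sum]
    rw [Finset.sum_comm]
    refine Finset.sum_congr rfl fun p _ => Finset.sum_congr rfl fun q _ => ?_
    ring
  have hskew : ∀ x, inner ℝ (Matrix.toEuclideanLin A.transpose x) x = 0 := by
    intro x
    have h : ∑ p, ∑ q, x p * A p q * x q = - ∑ p, ∑ q, x p * A p q * x q := by
      conv_lhs => rw [Finset.sum_comm]
      simp only [← Finset.sum_neg_distrib]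
      refine Finset.sum_congr rfl fun p _ => Finset.sum_congr rfl fun q _ => ?_
      have := congrFun (congrFun hA p) q
      simp only [Matrix.transpose_apply, Matrix.neg_apply] at this
      rw [this]
      ring
    rw [hinner]
    linarith
  obtain ⟨v, hv, -, hvT⟩ := exists_orthonormal_skew_triangular _ hskew k ⊤ (by
    simp [mul_comm])
  refine ⟨Matrix.of fun p q => v p q, ?_, ?_⟩
  · ext p q
    have h := orthonormal_iff_ite.1 hv p q
    rw [Matrix.one_apply, ← h]
    simp only [Matrix.mul_apply, Matrix.of_apply, Matrix.transpose_apply, PiLp.inner_apply,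
      RCLike.inner_apply, conj_trivial]
    exact Finset.sum_congr rfl fun _ _ => mul_comm _ _
  · intro i j b hij
    have h := hvT i j b hij
    rw [hinner, Finset.sum_comm] at h
    rw [← h]
    simp only [Matrix.mul_apply, Matrix.of_apply, Matrix.transpose_apply, Finset.sum_mul]

theorem Matrix.sum_sq_conj_orthogonal {ι : Type*} [Fintype ι] [DecidableEq ι] (P A : Matrix ι ι ℝ)
    (hP : P * P.transpose = 1) :
    ∑ i, ∑ j, (P * A * P.transpose) i j ^ 2 = ∑ i, ∑ j, A i j ^ 2 := by
  have h : ∀ B : Matrix ι ι ℝ, ∑ i, ∑ j, B i j ^ 2 = (B * B.transpose).trace := by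
    intro B
    simp [Matrix.trace, Matrix.mul_apply, sq]
  have hP' : P.transpose * P = 1 := mul_eq_one_comm.1 hP
  rw [h, h]
  have : P * A * P.transpose * (P * A * P.transpose).transpose =
      P * (A * A.transpose * P.transpose) := by
    simp only [Matrix.transpose_mul, Matrix.transpose_transpose]
    calc P * A * P.transpose * (P * (A.transpose * P.transpose))
        = P * A * (P.transpose * P) * (A.transpose * P.transpose) := by simp only [Matrix.mul_assoc]
      _ = _ := by rw [hP', Matrix.mul_one]; simp only [Matrix.mul_assoc]
  rw [this, Matrix.trace_mul_comm, Matrix.mul_assoc, hP', Matrix.mul_one]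

/-- Orthogonal conjugation changes the Pfaffian at most by a sign and keeps the sum of the squared
entries, which is at most `4 k² c²`. By skewness each of the `k` couplings in the triangular form
occurs twice in that sum, so the mean of their squares is at most `2 k c²`. -/
theorem pfaffian_sq_le_of_abs_le {k : ℕ} (A : Matrix (Fin k × Fin 2) (Fin k × Fin 2) ℝ)
    (hA : A.transpose = -A) {c : ℝ} (hc : ∀ p q, |A p q| ≤ c) :
    pfaffian A ^ 2 ≤ (2 * k * c ^ 2) ^ k := by
  obtain ⟨P, hP, htri⟩ := exists_orthogonal_conj_triangular A hA
  set D := P * A * P.transpose with hDdef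
  have hD : D.transpose = -D := by
    rw [hDdef]
    simp only [Matrix.transpose_mul, Matrix.transpose_transpose, hA]
    simp [Matrix.mul_assoc]
  have hdet : P.det ^ 2 = 1 := by
    have := congrArg Matrix.det hP
    simpa [sq] using this
  have hpf : pfaffian A ^ 2 = pfaffian D ^ 2 := by
    rw [hDdef, pfaffian_conj, mul_pow, hdet, one_mul]
  have hsumD : ∑ p, ∑ q, D p q ^ 2 ≤ 4 * k ^ 2 * c ^ 2 := by
    rw [hDdef, Matrix.sum_sq_conj_orthogonal P A hP]
    calc ∑ p, ∑ q, A p q ^ 2 ≤ ∑ _p : Fin k × Fin 2, ∑ _q : Fin k × Fin 2, c ^ 2 := by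
          refine Finset.sum_le_sum fun i _ => Finset.sum_le_sum fun j _ => ?_
          rw [← sq_abs]
          exact pow_le_pow_left₀ (abs_nonneg _) (hc i j) 2
      _ = _ := by simp; ring
  have hpair : 2 * ∑ i, D (i, 0) (i, 1) ^ 2 ≤ ∑ p, ∑ q, D p q ^ 2 := by
    rw [Fintype.sum_prod_type, Finset.mul_sum]
    refine Finset.sum_le_sum fun i _ => ?_
    have h10 : D (i, 1) (i, 0) ^ 2 = D (i, 0) (i, 1) ^ 2 := by
      have := congrFun (congrFun hD (i, 0)) (i, 1)
      simp only [Matrix.transpose_apply, Matrix.neg_apply] at this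
      rw [this, neg_sq]
    rw [Fin.sum_univ_two, two_mul]
    refine add_le_add ?_ ?_
    · exact Finset.single_le_sum (f := fun q => D (i, 0) q ^ 2) (fun _ _ => sq_nonneg _)
        (Finset.mem_univ (i, 1))
    · rw [← h10]
      exact Finset.single_le_sum (f := fun q => D (i, 1) q ^ 2) (fun _ _ => sq_nonneg _)
        (Finset.mem_univ (i, 0))
  rw [hpf, ← sq_abs]
  calc |pfaffian D| ^ 2 ≤ (∏ i, |D (i, 0) (i, 1)|) ^ 2 :=
        pow_le_pow_left₀ (abs_nonneg _) (abs_pfaffian_le_prod D hD htri) 2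
    _ = ∏ i, D (i, 0) (i, 1) ^ 2 := by
        rw [← Finset.prod_pow]
        simp only [sq_abs]
    _ ≤ ((∑ i, D (i, 0) (i, 1) ^ 2) / Fintype.card (Fin k)) ^ Fintype.card (Fin k) :=
        prod_le_mean_pow _ fun _ => sq_nonneg _
    _ ≤ _ := by
        rw [Fintype.card_fin]
        refine pow_le_pow_left₀ (by positivity) ?_ k
        refine div_le_of_le_mul₀ (Nat.cast_nonneg _) (by positivity) ?_
        nlinarith

/-! ### Perturbation of determinants and Pfaffians -/

/-- One factor is exchanged at a time. The condition `1 ≤ c` allows a single power of `c` to bound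
all the intermediate products. -/
theorem abs_prod_sub_prod_le {ι : Type*} (s : Finset ι) (a b : ι → ℝ) {c ε : ℝ} (hc : 1 ≤ c)
    (ha : ∀ i, |a i| ≤ c) (hb : ∀ i, |b i| ≤ c) (hab : ∀ i, |a i - b i| ≤ ε) :
    |∏ i ∈ s, a i - ∏ i ∈ s, b i| ≤ s.card * c ^ s.card * ε := by
  classical
  induction s using Finset.induction_on with
  | empty => simp
  | insert i s hi ih =>
    have hε : 0 ≤ ε := (abs_nonneg _).trans (hab i)
    have hpb : |∏ j ∈ s, b j| ≤ c ^ s.card := by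
      rw [Finset.abs_prod]
      exact (Finset.prod_le_prod (fun j _ => abs_nonneg _) fun j _ => hb j).trans_eq
        (Finset.prod_const c)
    rw [Finset.prod_insert hi, Finset.prod_insert hi, Finset.card_insert_of_notMem hi]
    have e : a i * ∏ j ∈ s, a j - b i * ∏ j ∈ s, b j =
        a i * (∏ j ∈ s, a j - ∏ j ∈ s, b j) + (a i - b i) * ∏ j ∈ s, b j := by ring
    rw [e]
    refine (abs_add_le _ _).trans ?_
    rw [abs_mul, abs_mul]
    have h1 : |a i| * |∏ j ∈ s, a j - ∏ j ∈ s, b j| ≤ c * (s.card * c ^ s.card * ε) :=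
      mul_le_mul (ha i) ih (abs_nonneg _) (by linarith)
    have h2 : |a i - b i| * |∏ j ∈ s, b j| ≤ ε * c ^ s.card :=
      mul_le_mul (hab i) hpb (abs_nonneg _) hε
    have h3 : ε * c ^ s.card ≤ ε * c ^ (s.card + 1) :=
      mul_le_mul_of_nonneg_left (pow_le_pow_right₀ hc (Nat.le_succ _)) hε
    push_cast
    calc _ ≤ c * (s.card * c ^ s.card * ε) + ε * c ^ (s.card + 1) := by linarith
      _ = _ := by ring

theorem abs_det_sub_det_le {n : ℕ} (A B : Matrix (Fin n) (Fin n) ℝ) {c ε : ℝ} (hc : 1 ≤ c)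
    (hA : ∀ i j, |A i j| ≤ c) (hB : ∀ i j, |B i j| ≤ c) (hAB : ∀ i j, |A i j - B i j| ≤ ε) :
    |A.det - B.det| ≤ n.factorial * (n * c ^ n * ε) := by
  rw [Matrix.det_apply', Matrix.det_apply', ← Finset.sum_sub_distrib]
  refine (Finset.abs_sum_le_sum_abs _ _).trans ?_
  calc _ ≤ ∑ _σ : Equiv.Perm (Fin n), n * c ^ n * ε := by
        refine Finset.sum_le_sum fun σ _ => ?_
        rw [← mul_sub, abs_mul]
        have := abs_prod_sub_prod_le Finset.univ (fun i => A (σ i) i) (fun i => B (σ i) i) hc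
          (fun i => hA _ _) (fun i => hB _ _) (fun i => hAB _ _)
        rw [Finset.card_univ, Fintype.card_fin] at this
        rcases Int.units_eq_one_or (Equiv.Perm.sign σ) with h | h <;> simpa [h] using this
    _ = _ := by
        rw [Finset.sum_const, Finset.card_univ, Fintype.card_perm, Fintype.card_fin, nsmul_eq_mul]

theorem abs_pfaffian_sub_pfaffian_le {k : ℕ} (A B : Matrix (Fin k × Fin 2) (Fin k × Fin 2) ℝ)
    {c ε : ℝ} (hc : 1 ≤ c)
    (hA : ∀ i j, |A i j| ≤ c) (hB : ∀ i j, |B i j| ≤ c) (hAB : ∀ i j, |A i j - B i j| ≤ ε)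
    (hε : 0 ≤ ε) :
    |pfaffian A - pfaffian B| ≤ 2 ^ k * k.factorial * (k * c ^ k * ε) := by
  unfold pfaffian
  rw [← mul_sub, ← Finset.sum_sub_distrib, abs_mul,
    abs_of_nonneg (by positivity : (0 : ℝ) ≤ 1 / (2 ^ k * (k.factorial : ℝ)))]
  have h : |∑ σ : Equiv.Perm (Fin k × Fin 2),
      (((Equiv.Perm.sign σ : ℤ) : ℝ) * ∏ i : Fin k, A (σ (i, 0)) (σ (i, 1)) -
        ((Equiv.Perm.sign σ : ℤ) : ℝ) * ∏ i : Fin k, B (σ (i, 0)) (σ (i, 1)))| ≤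
      (2 * k).factorial * (k * c ^ k * ε) := by
    refine (Finset.abs_sum_le_sum_abs _ _).trans ?_
    calc _ ≤ ∑ _σ : Equiv.Perm (Fin k × Fin 2), k * c ^ k * ε := by
          refine Finset.sum_le_sum fun σ _ => ?_
          rw [← mul_sub, abs_mul]
          have := abs_prod_sub_prod_le Finset.univ (fun i => A (σ (i, 0)) (σ (i, 1)))
            (fun i => B (σ (i, 0)) (σ (i, 1))) hc
            (fun i => hA _ _) (fun i => hB _ _) (fun i => hAB _ _)
          rw [Finset.card_univ, Fintype.card_fin] at this
          rcases Int.units_eq_one_or (Equiv.Perm.sign σ) with h | h <;> simpa [h] using this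
      _ = _ := by
          rw [Finset.sum_const, Finset.card_univ, Fintype.card_perm, Fintype.card_prod,
            Fintype.card_fin, Fintype.card_fin, nsmul_eq_mul, mul_comm k 2]
  -- The `(2k)!` terms are reduced by the normalization to `2 ^ k * k!`, because the central
  -- binomial coefficient is at most `4 ^ k`.
  have hfac : ((2 * k).factorial : ℝ) ≤ 4 ^ k * (k.factorial : ℝ) ^ 2 := by
    have h1 := Nat.choose_mul_factorial_mul_factorial (show k ≤ 2 * k by omega)
    have h2 : (2 * k).choose k ≤ 2 ^ (2 * k) := Nat.choose_le_two_pow _ _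
    rw [show 2 * k - k = k by omega] at h1
    have h3 : (2 * k).factorial ≤ 4 ^ k * k.factorial ^ 2 := by
      rw [← h1, mul_assoc, ← sq]
      rw [pow_mul] at h2
      exact Nat.mul_le_mul_right _ h2
    exact_mod_cast h3
  calc _ ≤ 1 / (2 ^ k * (k.factorial : ℝ)) *
        ((4 ^ k * (k.factorial : ℝ) ^ 2) * (k * c ^ k * ε)) := by
        refine mul_le_mul_of_nonneg_left (h.trans ?_) (by positivity)
        exact mul_le_mul_of_nonneg_right hfac (by positivity)
    _ = _ := by
        have : (4 : ℝ) ^ k = 2 ^ k * 2 ^ k := by rw [← mul_pow]; norm_num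
        rw [this]
        field_simp

theorem blockKernel_mul_blockJ_apply (K : ℝ → ℝ → Matrix (Fin 2) (Fin 2) ℝ) {k : ℕ}
    (t : Fin k → ℝ) (p q : Fin k × Fin 2) :
    (blockKernel K t * blockJ k) p q =
      (if q.2 = 0 then -1 else 1) * K (t p.1) (t q.1) p.2 (1 - q.2) := by
  obtain ⟨j, c⟩ := q
  rw [Matrix.mul_apply, Fintype.sum_prod_type, Finset.sum_eq_single j]
  · fin_cases c <;> simp [blockKernel, blockJ, Fin.sum_univ_two]
  · intro b _ hb
    simp [blockJ, hb]
  · simp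

/-! ### The limiting kernels -/

theorem abs_mul_cos_sub_sin_le (x : ℝ) : |x * Real.cos x - Real.sin x| ≤ x ^ 2 := by
  have pos : ∀ x : ℝ, 0 ≤ x → |x * Real.cos x - Real.sin x| ≤ x ^ 2 := by
    intro x hx
    have hd : ∀ y : ℝ, HasDerivAt (fun y => y * Real.cos y - Real.sin y)
        (-(y * Real.sin y)) y := by
      intro y
      have h := ((hasDerivAt_id y).mul (Real.hasDerivAt_cos y)).sub (Real.hasDerivAt_sin y)
      refine h.congr_deriv ?_
      simp
    -- The derivative `-y sin y` is dominated by `2y`; the values `s = 1` and `s = -1` give the two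
    -- sides of the estimate.
    have mono : ∀ s : ℝ, |s| ≤ 1 →
        MonotoneOn (fun y => y ^ 2 + s * (y * Real.cos y - Real.sin y)) (Set.Ici 0) := by
      intro s hs
      have hd' : ∀ y : ℝ, HasDerivAt (fun y => y ^ 2 + s * (y * Real.cos y - Real.sin y))
          (2 * y + s * (-(y * Real.sin y))) y := fun y => by
        have h := (hasDerivAt_pow 2 y).add ((hd y).const_mul s)
        refine h.congr_deriv ?_
        simp
      refine monotoneOn_of_deriv_nonneg (convex_Ici 0)
        (fun y _ => (hd' y).continuousAt.continuousWithinAt)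
        (fun y _ => (hd' y).differentiableAt.differentiableWithinAt) fun y hy => ?_
      rw [(hd' y).deriv]
      rw [interior_Ici, Set.mem_Ioi] at hy
      have h1 : |s * Real.sin y| ≤ 1 := by
        rw [abs_mul]
        exact mul_le_one₀ hs (abs_nonneg _) (Real.abs_sin_le_one y)
      have h2 := (abs_le.1 h1).2
      nlinarith
    have h1 := mono 1 (by simp) (Set.mem_Ici.2 le_rfl) hx hx
    have h2 := mono (-1) (by simp) (Set.mem_Ici.2 le_rfl) hx hx
    simp at h1 h2
    rw [abs_le]
    constructor <;> linarith
  rcases le_total 0 x with h | h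
  · exact pos x h
  · have := pos (-x) (by linarith)
    rw [Real.cos_neg, Real.sin_neg, neg_sq] at this
    rwa [show -x * Real.cos x - -Real.sin x = -(x * Real.cos x - Real.sin x) by ring,
      abs_neg] at this

theorem deriv_sinc_neg (x : ℝ) : deriv Real.sinc (-x) = -deriv Real.sinc x := by
  have h := deriv_comp_neg Real.sinc x
  have e : (fun x => Real.sinc (-x)) = Real.sinc := funext Real.sinc_neg
  rw [e] at h
  linarith

theorem abs_deriv_sinc_le (x : ℝ) : |deriv Real.sinc x| ≤ 1 := by
  rcases eq_or_ne x 0 with rfl | hx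
  · have := deriv_sinc_neg 0
    rw [neg_zero] at this
    have h0 : deriv Real.sinc 0 = 0 := by linarith
    simp [h0]
  · have hd : HasDerivAt (fun y => Real.sin y / y) ((Real.cos x * x - Real.sin x * 1) / x ^ 2) x :=
      (Real.hasDerivAt_sin x).div (hasDerivAt_id x) hx
    have he : Real.sinc =ᶠ[𝓝 x] fun y => Real.sin y / y := by
      filter_upwards [isOpen_ne.mem_nhds hx] with y hy
      exact Real.sinc_of_ne_zero hy
    rw [he.deriv_eq, hd.deriv, abs_div, abs_of_nonneg (sq_nonneg x)]
    refine div_le_one_of_le₀ ?_ (sq_nonneg x)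
    rw [mul_one, mul_comm]
    exact abs_mul_cos_sub_sin_le x

theorem integral_sinc_neg (z : ℝ) :
    ∫ t in (0 : ℝ)..(-z), Real.sinc t = -∫ t in (0 : ℝ)..z, Real.sinc t := by
  have h := intervalIntegral.integral_comp_neg (a := 0) (b := z) Real.sinc
  simp only [Real.sinc_neg, neg_zero] at h
  rw [h, intervalIntegral.integral_symm]

/-- The bound has to be uniform because the windows grow. Beyond 1, integration by parts is used:
the integral plus `cos y / y` has derivative `-cos y / y²`, which is dominated by the derivative of
`-1/y`. The constant is not optimized. -/
theorem abs_integral_sinc_le (z : ℝ) : |∫ t in (0 : ℝ)..z, Real.sinc t| ≤ 5 := by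
  have hint : ∀ a b, IntervalIntegrable Real.sinc volume a b := fun a b =>
    Real.continuous_sinc.intervalIntegrable a b
  have small : ∀ z : ℝ, 0 ≤ z → z ≤ 1 → |∫ t in (0 : ℝ)..z, Real.sinc t| ≤ 1 := by
    intro z h0 h1
    have := intervalIntegral.norm_integral_le_of_norm_le_const (a := 0) (b := z) (C := 1)
      (f := Real.sinc) fun x _ => by simpa using Real.abs_sinc_le_one x
    rw [Real.norm_eq_abs, sub_zero, one_mul, abs_of_nonneg h0] at this
    linarith
  have pos : ∀ z : ℝ, 0 ≤ z → |∫ t in (0 : ℝ)..z, Real.sinc t| ≤ 5 := by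
    intro z hz
    rcases le_total z 1 with h1 | h1
    · linarith [small z hz h1]
    have hd : ∀ y : ℝ, 0 < y → HasDerivAt
        (fun y => (∫ t in (0 : ℝ)..y, Real.sinc t) + Real.cos y / y) (-(Real.cos y / y ^ 2)) y := by
      intro y hy
      have h := (intervalIntegral.integral_hasDerivAt_right (hint 0 y)
        (Real.continuous_sinc.stronglyMeasurableAtFilter _ _) Real.continuous_sinc.continuousAt).add
        ((Real.hasDerivAt_cos y).div (hasDerivAt_id y) hy.ne')
      refine h.congr_deriv ?_
      rw [Real.sinc_of_ne_zero hy.ne']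
      simp only [id]
      field_simp
      ring
    have mono : ∀ s : ℝ, |s| ≤ 1 → MonotoneOn
        (fun y => -y⁻¹ + s * ((∫ t in (0 : ℝ)..y, Real.sinc t) + Real.cos y / y)) (Set.Ici 1) := by
      intro s hs
      have hd' : ∀ y : ℝ, 0 < y → HasDerivAt
          (fun y => -y⁻¹ + s * ((∫ t in (0 : ℝ)..y, Real.sinc t) + Real.cos y / y))
          ((y ^ 2)⁻¹ + s * (-(Real.cos y / y ^ 2))) y := fun y hy => by
        have h := (hasDerivAt_inv hy.ne').neg.add ((hd y hy).const_mul s)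
        refine h.congr_deriv ?_
        simp
      refine monotoneOn_of_deriv_nonneg (convex_Ici 1)
        (fun y hy => (hd' y (lt_of_lt_of_le one_pos hy)).continuousAt.continuousWithinAt)
        (fun y hy => ?_) fun y hy => ?_
      · rw [interior_Ici, Set.mem_Ioi] at hy
        exact (hd' y (one_pos.trans hy)).differentiableAt.differentiableWithinAt
      · rw [interior_Ici, Set.mem_Ioi] at hy
        rw [(hd' y (one_pos.trans hy)).deriv]
        have h1 : |s * Real.cos y| ≤ 1 := by
          rw [abs_mul]
          exact mul_le_one₀ hs (abs_nonneg _) (Real.abs_cos_le_one y)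
        have h2 := (abs_le.1 h1).2
        have h3 : (y ^ 2)⁻¹ + s * (-(Real.cos y / y ^ 2)) = (1 - s * Real.cos y) / y ^ 2 := by
          field_simp
          ring
        rw [h3]
        exact div_nonneg (by linarith) (sq_nonneg _)
    have m1 := mono 1 (by simp) (Set.mem_Ici.2 le_rfl) h1 h1
    have m2 := mono (-1) (by simp) (Set.mem_Ici.2 le_rfl) h1 h1
    have hb := abs_le.1 (small 1 zero_le_one le_rfl)
    have hcz : |Real.cos z / z| ≤ 1 := by
      rw [abs_div, abs_of_nonneg hz]
      exact div_le_one_of_le₀ ((Real.abs_cos_le_one z).trans h1) hz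
    have hcz' := abs_le.1 hcz
    have hc1 := Real.cos_le_one 1
    have hc2 := Real.neg_one_le_cos 1
    have hz1 : z⁻¹ ≤ 1 := inv_le_one_of_one_le₀ h1
    have hz0 : 0 ≤ z⁻¹ := inv_nonneg.2 hz
    simp at m1 m2
    rw [abs_le]
    constructor <;> linarith
  rcases le_total 0 z with h | h
  · exact pos z h
  · have := pos (-z) (by linarith)
    rwa [integral_sinc_neg, abs_neg] at this

/-- The common form of the limiting matrix kernels: `c = π`, `e = 1/2` for `β = 1` and `c = 2π`,
`e = 0` for `β = 4`. -/
noncomputable def sincMatrixKernel (c e x y : ℝ) : Matrix (Fin 2) (Fin 2) ℝ :=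
  !![Real.sinc (c * (x - y)), c * deriv Real.sinc (c * (x - y));
     c⁻¹ * (∫ t in (0 : ℝ)..(c * (x - y)), Real.sinc t) - e * Real.sign (x - y),
     Real.sinc (c * (x - y))]

theorem deriv_sinc_mul_sub (c x y : ℝ) :
    deriv (fun u => Real.sinc (c * (u - y))) x = c * deriv Real.sinc (c * (x - y)) := by
  have h1 := deriv_comp_sub_const (f := fun v => Real.sinc (c * v)) y x
  rw [h1]
  have h2 := deriv_comp_mul_left c Real.sinc (x - y)
  simpa using h2

theorem limitKernelOne_eq : limitKernelOne = sincMatrixKernel Real.pi (1 / 2) := by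
  ext x y i j
  simp only [limitKernelOne, sincMatrixKernel, sineKernel, deriv_sinc_mul_sub, sub_zero]
  rw [intervalIntegral.integral_comp_mul_left _ Real.pi_ne_zero]
  simp

theorem limitKernelFour_eq : limitKernelFour = sincMatrixKernel (2 * Real.pi) 0 := by
  ext x y i j
  have h : ∀ x y : ℝ, Real.pi * (2 * x - 2 * y) = 2 * Real.pi * (x - y) := fun x y => by ring
  have h' : ∀ x y : ℝ, Real.pi * (2 * x - 0) = 2 * Real.pi * x := fun x y => by ring
  simp only [limitKernelFour, sincMatrixKernel, sineKernel, h, h' _ 0, deriv_sinc_mul_sub]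
  rw [intervalIntegral.integral_comp_mul_left _ (by positivity)]
  simp

/-- The range of `c` covers `π` and `2π`. The derivative entry is at most `c ≤ 7`, and the integral
entry at most `5 + 1`. -/
theorem abs_sincMatrixKernel_le {c e : ℝ} (hc : 1 ≤ c) (hc' : c ≤ 7) (he : 0 ≤ e) (he' : e ≤ 1)
    (x y : ℝ) (i j : Fin 2) : |sincMatrixKernel c e x y i j| ≤ 7 := by
  have hs : |Real.sinc (c * (x - y))| ≤ 7 := (Real.abs_sinc_le_one _).trans (by norm_num)
  have hsign : |Real.sign (x - y)| ≤ 1 := by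
    rcases Real.sign_apply_eq (x - y) with h | h | h <;> rw [h] <;> simp
  fin_cases i <;> fin_cases j
  · simpa [sincMatrixKernel] using hs
  · simp only [sincMatrixKernel, Fin.zero_eta, Fin.mk_one, Matrix.of_apply, Matrix.cons_val_zero,
      Matrix.cons_val_one, abs_mul, abs_of_nonneg (zero_le_one.trans hc)]
    have := abs_deriv_sinc_le (c * (x - y))
    nlinarith [abs_nonneg (deriv Real.sinc (c * (x - y)))]
  · simp only [sincMatrixKernel, Fin.zero_eta, Fin.mk_one, Matrix.of_apply, Matrix.cons_val_zero,
      Matrix.cons_val_one]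
    refine (abs_sub _ _).trans ?_
    rw [abs_mul, abs_mul, abs_of_nonneg (inv_nonneg.2 (zero_le_one.trans hc)), abs_of_nonneg he]
    have h1 := abs_integral_sinc_le (c * (x - y))
    have h2 : c⁻¹ * |∫ t in (0 : ℝ)..(c * (x - y)), Real.sinc t| ≤ 1 * 5 :=
      mul_le_mul (inv_le_one_of_one_le₀ hc) h1 (abs_nonneg _) zero_le_one
    have h3 : e * |Real.sign (x - y)| ≤ 1 * 1 :=
      mul_le_mul he' hsign (abs_nonneg _) zero_le_one
    linarith
  · simpa [sincMatrixKernel] using hs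

/-- `sinc` is even, while its derivative, its primitive from 0 and the sign function are odd. -/
theorem sincMatrixKernel_mul_blockJ_skew (c e : ℝ) {k : ℕ} (t : Fin k → ℝ) :
    (blockKernel (sincMatrixKernel c e) t * blockJ k).transpose =
      -(blockKernel (sincMatrixKernel c e) t * blockJ k) := by
  have hsinc : ∀ x y, Real.sinc (c * (x - y)) = Real.sinc (c * (y - x)) := fun x y => by
    rw [← Real.sinc_neg]; congr 1; ring
  have hder : ∀ x y, deriv Real.sinc (c * (x - y)) = -deriv Real.sinc (c * (y - x)) := fun x y => by
    rw [← deriv_sinc_neg]; congr 1; ring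
  have hI : ∀ x y, (∫ t in (0 : ℝ)..(c * (x - y)), Real.sinc t) =
      -∫ t in (0 : ℝ)..(c * (y - x)), Real.sinc t := fun x y => by
    rw [← integral_sinc_neg]; congr 1; ring
  have hsign : ∀ x y, Real.sign (x - y) = -Real.sign (y - x) := fun x y => by
    rw [← Real.sign_neg]; congr 1; ring
  ext ⟨i, a⟩ ⟨j, b⟩
  rw [Matrix.transpose_apply, Matrix.neg_apply, blockKernel_mul_blockJ_apply,
    blockKernel_mul_blockJ_apply]
  fin_cases a <;> fin_cases b <;> simp [sincMatrixKernel]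
  · rw [hder]; ring
  · rw [hsinc]
  · rw [hsinc]
  · rw [hI, hsign]; ring

theorem measurable_sincMatrixKernel (c e : ℝ) (i j : Fin 2) :
    Measurable fun p : ℝ × ℝ => sincMatrixKernel c e p.1 p.2 i j := by
  have hd : Measurable fun p : ℝ × ℝ => c * (p.1 - p.2) := by fun_prop
  have hF : Measurable fun z : ℝ => ∫ t in (0 : ℝ)..z, Real.sinc t :=
    (intervalIntegral.continuous_primitive
      (fun a b => Real.continuous_sinc.intervalIntegrable a b) 0).measurable
  have hsign : Measurable Real.sign := by
    unfold Real.sign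
    exact Measurable.ite measurableSet_Iio measurable_const
      (Measurable.ite measurableSet_Ioi measurable_const measurable_const)
  fin_cases i <;> fin_cases j
  · simpa [sincMatrixKernel] using hd.sinc
  · simpa [sincMatrixKernel] using ((measurable_deriv Real.sinc).comp hd).const_mul c
  · simpa [sincMatrixKernel, Pi.sub_def] using ((hF.comp hd).const_mul c⁻¹).sub
      ((hsign.comp (by fun_prop : Measurable fun p : ℝ × ℝ => p.1 - p.2)).const_mul e)
  · simpa [sincMatrixKernel] using hd.sinc

theorem measurable_pfaffian_blockKernel (K : ℝ → ℝ → Matrix (Fin 2) (Fin 2) ℝ)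
    (hK : ∀ i j, Measurable fun p : ℝ × ℝ => K p.1 p.2 i j) (k : ℕ) :
    Measurable fun t : Fin k → ℝ => pfaffian (blockKernel K t * blockJ k) := by
  unfold pfaffian
  simp only [blockKernel_mul_blockJ_apply]
  refine Measurable.const_mul ?_ _
  refine Finset.measurable_sum _ fun σ _ => Measurable.const_mul ?_ _
  refine Finset.measurable_prod _ fun i _ => Measurable.const_mul ?_ _
  exact (hK _ _).comp (Measurable.prodMk (measurable_pi_apply _) (measurable_pi_apply _))

theorem measurable_limitCorrelation (β : DysonIndex) (k : ℕ) :
    Measurable (limitCorrelation β k) := by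
  cases β
  · unfold limitCorrelation
    rw [limitKernelOne_eq]
    exact measurable_pfaffian_blockKernel _ (measurable_sincMatrixKernel _ _) k
  · unfold limitCorrelation
    simp only [Matrix.det_apply']
    refine Finset.measurable_sum _ fun σ _ => Measurable.const_mul ?_ _
    refine Finset.measurable_prod _ fun i _ => ?_
    simp only [Matrix.of_apply, sineKernel]
    have : Measurable fun t : Fin k → ℝ => Real.pi * (t (σ i) - t i) := by fun_prop
    exact this.sinc
  · unfold limitCorrelation
    rw [limitKernelFour_eq]
    exact measurable_pfaffian_blockKernel _ (measurable_sincMatrixKernel _ _) k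

/-- The limiting kernels depend on `x - y` only. This invariance makes the integral over the window
proportional to its length. -/
theorem limitCorrelation_add_const (β : DysonIndex) (k : ℕ) (t : Fin k → ℝ) (u : ℝ) :
    limitCorrelation β k (fun i => u + t i) = limitCorrelation β k t := by
  have h : ∀ c e x y, sincMatrixKernel c e (u + x) (u + y) = sincMatrixKernel c e x y := by
    intro c e x y
    simp [sincMatrixKernel]
  cases β
  · simp [limitCorrelation, limitKernelOne_eq, blockKernel, h]
  · simp [limitCorrelation, sineKernel]
  · simp [limitCorrelation, limitKernelFour_eq, blockKernel, h]

theorem abs_blockKernel_mul_blockJ_le {K : ℝ → ℝ → Matrix (Fin 2) (Fin 2) ℝ} {k : ℕ}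
    {t : Fin k → ℝ} {c : ℝ} (h : ∀ i j a b, |K (t i) (t j) a b| ≤ c) (p q : Fin k × Fin 2) :
    |(blockKernel K t * blockJ k) p q| ≤ c := by
  rw [blockKernel_mul_blockJ_apply, abs_mul]
  split_ifs <;> simpa using h _ _ _ _

theorem limitCorrelation_sq_le (β : DysonIndex) (k : ℕ) (t : Fin k → ℝ) :
    limitCorrelation β k t ^ 2 ≤ (2 * k * 7 ^ 2) ^ k := by
  have hpi3 := Real.pi_gt_three
  have hpi4 := Real.pi_lt_d2
  cases β
  · simp only [limitCorrelation, limitKernelOne_eq]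
    refine pfaffian_sq_le_of_abs_le _ (sincMatrixKernel_mul_blockJ_skew _ _ _) ?_
    exact abs_blockKernel_mul_blockJ_le fun i j a b =>
      abs_sincMatrixKernel_le (by linarith) (by linarith) (by norm_num) (by norm_num) _ _ _ _
  · simp only [limitCorrelation]
    refine (Matrix.det_sq_le_of_abs_le _ (c := 1) fun i j => Real.abs_sinc_le_one _).trans ?_
    refine pow_le_pow_left₀ (by positivity) ?_ k
    have : (0 : ℝ) ≤ k := Nat.cast_nonneg k
    linarith
  · simp only [limitCorrelation, limitKernelFour_eq]
    refine pfaffian_sq_le_of_abs_le _ (sincMatrixKernel_mul_blockJ_skew _ _ _) ?_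
    exact abs_blockKernel_mul_blockJ_le fun i j a b =>
      abs_sincMatrixKernel_le (by linarith) (by linarith) (by norm_num) (by norm_num) _ _ _ _

/-- The base 10 comes from `2 * 7 ^ 2 = 98 ≤ 10 ^ 2`. -/
theorem abs_limitCorrelation_le (β : DysonIndex) (k : ℕ) (t : Fin k → ℝ) :
    |limitCorrelation β k t| ≤ 10 ^ k * (k : ℝ) ^ ((k : ℝ) / 2) := by
  have h := limitCorrelation_sq_le β k t
  refine abs_le_of_sq_le_sq ?_ (by positivity)
  refine h.trans ?_
  have e : ((k : ℝ) ^ ((k : ℝ) / 2)) ^ 2 = (k : ℝ) ^ k := by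
    rw [← Real.rpow_mul_natCast (Nat.cast_nonneg k), ← Real.rpow_natCast]
    congr 1
    push_cast
    ring
  rw [mul_pow _ _ 2, e, ← pow_mul, mul_comm k 2, pow_mul, ← mul_pow]
  refine pow_le_pow_left₀ (by positivity) ?_ k
  have : (0 : ℝ) ≤ k := Nat.cast_nonneg k
  linarith

/-! ### Convergence of the correlation functions -/

theorem sq_mul_le_four_pow (k : ℕ) : (k : ℝ) * k ≤ 4 ^ k := by
  have h : (k : ℝ) ≤ 2 ^ k := by exact_mod_cast (Nat.lt_two_pow_self).le
  have : (4 : ℝ) ^ k = 2 ^ k * 2 ^ k := by rw [← mul_pow]; norm_num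
  rw [this]
  exact mul_le_mul h h (Nat.cast_nonneg k) (by positivity)

/-- Here `k * k! = k² (k-1)!` and `k² ≤ 4 ^ k`. The factorial `(k-1)!` is singled out because it
cancels against the volume of the ordered simplex. -/
theorem factorial_mul_error_le {k : ℕ} (hk : 1 ≤ k) {c M e : ℝ} (hc : 1 ≤ c) (hM : 1 ≤ M)
    (he : 0 ≤ e) :
    2 ^ k * k.factorial * (k * c ^ k * (M * e)) ≤ (8 * c * M) ^ k * (k - 1).factorial * e := by
  have hf : (k.factorial : ℝ) = k * (k - 1).factorial := by
    exact_mod_cast (Nat.mul_factorial_pred (by omega)).symm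
  have hMk : M ≤ M ^ k := le_self_pow₀ hM (by omega)
  have h4 := sq_mul_le_four_pow k
  have e8 : (8 * c * M) ^ k = 2 ^ k * 4 ^ k * c ^ k * M ^ k := by
    rw [mul_pow, mul_pow, ← mul_pow 2 4]; norm_num
  rw [hf, e8]
  calc 2 ^ k * ((k : ℝ) * (k - 1).factorial) * (k * c ^ k * (M * e))
      = 2 ^ k * (k * k) * c ^ k * M * ((k - 1).factorial * e) := by ring
    _ ≤ 2 ^ k * 4 ^ k * c ^ k * M ^ k * ((k - 1).factorial * e) := by gcongr
    _ = _ := by ring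

/-- A convergent sequence `κ` is bounded, so the kernels are bounded on the windows uniformly in
`N`, and the perturbation estimates hold with one constant for every `N`. -/
theorem exists_abs_rescaledCorrelation_sub_le {β : DysonIndex} {V : ℝ → ℝ} {ρ a : ℝ} {δ κ : ℕ → ℝ}
    (hκ : Tendsto κ atTop (𝓝 0)) (hK : KernelsConverge β V ρ a δ κ) :
    ∃ C : ℝ, 1 ≤ C ∧ ∀ N k : ℕ, 1 ≤ k → k ≤ N → ∀ t : Fin k → ℝ,
      (∀ i, t i ∈ rescaledWindow ρ a δ N) →
      |rescaledCorrelation β V ρ a N k t - limitCorrelation β k t| ≤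
        C ^ k * (k - 1).factorial * |κ N| := by
  obtain ⟨b, hb⟩ : ∃ b, ∀ N, |κ N| ≤ b := by
    obtain ⟨b, hb⟩ := hκ.abs.bddAbove_range
    exact ⟨b, fun N => hb ⟨N, rfl⟩⟩
  have hb0 : 0 ≤ b := (abs_nonneg _).trans (hb 0)
  have hpi3 := Real.pi_gt_three
  have hpi4 := Real.pi_lt_d2
  have pf : ∀ (γ : DysonIndex) (c e : ℝ), 1 ≤ c → c ≤ 7 → 0 ≤ e → e ≤ 1 →
      PfaffianKernelsConverge γ V ρ a δ κ (sincMatrixKernel c e) →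
      ∃ C : ℝ, 1 ≤ C ∧ ∀ N k : ℕ, 1 ≤ k → k ≤ N → ∀ t : Fin k → ℝ,
      (∀ i, t i ∈ rescaledWindow ρ a δ N) →
      |rescaledCorrelation γ V ρ a N k t -
          pfaffian (blockKernel (sincMatrixKernel c e) t * blockJ k)| ≤
        C ^ k * (k - 1).factorial * |κ N| := by
    rintro γ c e hc hc' he he' ⟨K, hK, M, hM⟩
    have hMb : 0 ≤ |M| * b := by positivity
    -- `7 + |M| * b` bounds the entries of both kernels, and `1 + |M|` replaces `M` by a constant
    -- that is at least 1.
    refine ⟨8 * (7 + |M| * b) * (1 + |M|), by nlinarith [abs_nonneg M], ?_⟩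
    intro N k hk hkN t ht
    rw [(hK N (by omega) k hk hkN t).2]
    have hdiff : ∀ i j a' b', |K N (unscale ρ a N (t i)) (unscale ρ a N (t j)) a' b' -
        sincMatrixKernel c e (t i) (t j) a' b'| ≤ (1 + |M|) * |κ N| := fun i j a' b' =>
      (hM N (by omega) _ (ht i) _ (ht j) a' b').trans (by
        gcongr
        linarith [le_abs_self M])
    have hdiff' : ∀ i j a' b', |K N (unscale ρ a N (t i)) (unscale ρ a N (t j)) a' b' -
        sincMatrixKernel c e (t i) (t j) a' b'| ≤ |M| * b := fun i j a' b' =>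
      (hM N (by omega) _ (ht i) _ (ht j) a' b').trans (by
        gcongr
        · exact le_abs_self M
        · exact hb N)
    have hL : ∀ i j a' b', |sincMatrixKernel c e (t i) (t j) a' b'| ≤ 7 + |M| * b :=
      fun i j a' b' => (abs_sincMatrixKernel_le hc hc' he he' _ _ _ _).trans (by linarith)
    have hKb : ∀ i j a' b', |K N (unscale ρ a N (t i)) (unscale ρ a N (t j)) a' b'| ≤
        7 + |M| * b := fun i j a' b' => by
      have h1 := abs_sincMatrixKernel_le hc hc' he he' (t i) (t j) a' b'
      have h2 := hdiff' i j a' b'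
      have h3 := abs_sub_abs_le_abs_sub (K N (unscale ρ a N (t i)) (unscale ρ a N (t j)) a' b')
        (sincMatrixKernel c e (t i) (t j) a' b')
      linarith
    refine (abs_pfaffian_sub_pfaffian_le (ε := (1 + |M|) * |κ N|) _ _ (by linarith)
      (abs_blockKernel_mul_blockJ_le hKb) (abs_blockKernel_mul_blockJ_le hL) ?_
      (by positivity)).trans
      (factorial_mul_error_le hk (by linarith) (by linarith [abs_nonneg M]) (abs_nonneg _))
    intro p q
    rw [blockKernel_mul_blockJ_apply, blockKernel_mul_blockJ_apply, ← mul_sub, abs_mul]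
    split_ifs <;> simpa using hdiff _ _ _ _
  cases β
  · simp only [KernelsConverge, limitKernelOne_eq] at hK
    simp only [limitCorrelation, limitKernelOne_eq]
    exact pf _ _ _ (by linarith) (by linarith) (by norm_num) (by norm_num) hK
  · obtain ⟨K, hK, M, hM⟩ := hK
    have hMb : 0 ≤ |M| * b := by positivity
    refine ⟨8 * (7 + |M| * b) * (1 + |M|), by nlinarith [abs_nonneg M], ?_⟩
    intro N k hk hkN t ht
    rw [hK N (by omega) k hk hkN t]
    simp only [limitCorrelation]
    have hs : ∀ i j, |sineKernel (t i) (t j)| ≤ 1 := fun i j => Real.abs_sinc_le_one _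
    have hd := fun i j => hM N (by omega) _ (ht i) _ (ht j)
    have hle : M * |κ N| ≤ |M| * b := by
      gcongr
      · exact le_abs_self M
      · exact hb N
    refine (abs_det_sub_det_le (c := 7 + |M| * b) (ε := (1 + |M|) * |κ N|) _ _ (by linarith)
      (fun i j => ?_) (fun i j => (hs i j).trans (by linarith)) (fun i j => ?_)).trans (le_trans ?_
      (factorial_mul_error_le hk (c := 7 + |M| * b) (by linarith) (by linarith [abs_nonneg M])
        (abs_nonneg _)))
    · have h3 := abs_sub_abs_le_abs_sub (K N (unscale ρ a N (t i)) (unscale ρ a N (t j)))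
        (sineKernel (t i) (t j))
      simp only [Matrix.of_apply]
      linarith [hd i j, hs i j]
    · refine (hd i j).trans ?_
      gcongr
      linarith [le_abs_self M]
    -- The determinant estimate has no factor `2 ^ k`; it is inserted to reach the form shared with
    -- the Pfaffian case.
    · refine mul_le_mul_of_nonneg_right ?_ (by positivity)
      exact le_mul_of_one_le_left (Nat.cast_nonneg _) (one_le_pow₀ (by norm_num))
  · simp only [KernelsConverge, limitKernelFour_eq] at hK
    simp only [limitCorrelation, limitKernelFour_eq]
    exact pf _ _ _ (by linarith) (by linarith) (by norm_num) (by norm_num) hK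

/-! ### Symmetrization over the Weyl chamber -/

theorem measurePreserving_comp_equiv {ι κ : Type*} [Fintype ι] [Fintype κ] (e : ι ≃ κ) :
    MeasurePreserving (fun x : κ → ℝ => x ∘ e) volume volume := by
  exact volume_preserving_arrowCongr' e.symm (MeasurableEquiv.refl ℝ)
    (MeasurePreserving.id volume)

theorem measurableEmbedding_comp_equiv {ι κ : Type*} (e : ι ≃ κ) :
    MeasurableEmbedding (fun x : κ → ℝ => x ∘ e) :=
  (MeasurableEquiv.arrowCongr' e.symm (MeasurableEquiv.refl ℝ)).measurableEmbedding

/-- Each coincidence `x i = x j` with `i ≠ j` defines a proper subspace, which is a null set. -/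
theorem ae_injective (N : ℕ) : ∀ᵐ x : Fin N → ℝ, Function.Injective x := by
  have h : ∀ i j : Fin N, i ≠ j → ∀ᵐ x : Fin N → ℝ, x i ≠ x j := by
    intro i j hij
    have hz := Measure.addHaar_submodule (volume : Measure (Fin N → ℝ))
      (LinearMap.ker ((LinearMap.proj i : (Fin N → ℝ) →ₗ[ℝ] ℝ) - LinearMap.proj j)) (by
        intro htop
        have : (Pi.single i 1 : Fin N → ℝ) ∈
            LinearMap.ker ((LinearMap.proj i : (Fin N → ℝ) →ₗ[ℝ] ℝ) - LinearMap.proj j) := by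
          rw [htop]; trivial
        simp [hij.symm] at this)
    refine measure_mono_null (fun x hx => ?_) hz
    simp only [Set.mem_compl_iff, Set.mem_ofPred_eq, not_not] at hx
    simp [hx]
  have h' : ∀ᵐ x : Fin N → ℝ, ∀ i j : Fin N, i ≠ j → x i ≠ x j := by
    rw [ae_all_iff]; intro i
    rw [ae_all_iff]; intro j
    by_cases hij : i = j
    · simp [hij]
    · filter_upwards [h i j hij] with x hx _ using hx
  filter_upwards [h'] with x hx i j hij
  by_contra hne
  exact hx i j hne hij

theorem measurableSet_setOf_monotone (N : ℕ) : MeasurableSet {x : Fin N → ℝ | Monotone x} := by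
  have : {x : Fin N → ℝ | Monotone x} = ⋂ i, ⋂ j, ⋂ _ : i ≤ j, {x | x i ≤ x j} := by
    ext x
    simp [Monotone]
  rw [this]
  exact MeasurableSet.iInter fun i => MeasurableSet.iInter fun j => MeasurableSet.iInter fun _ =>
    measurableSet_le (measurable_pi_apply i) (measurable_pi_apply j)

theorem measurableSet_weylChamber (N : ℕ) : MeasurableSet (weylChamber N) :=
  measurableSet_setOf_monotone N

/-- The integral of a symmetric function is `N!` times its integral over the Weyl chamber. -/
theorem integral_eq_factorial_mul_setIntegral_weylChamber {N : ℕ} {g : (Fin N → ℝ) → ℝ}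
    (hg : Integrable g) (hsymm : ∀ (σ : Equiv.Perm (Fin N)) x, g (x ∘ σ) = g x) :
    ∫ x, g x = N.factorial * ∫ x in weylChamber N, g x := by
  classical
  have hch := measurableSet_weylChamber N
  -- For pairwise distinct coordinates exactly one permutation, the sorting one, moves the point
  -- into the chamber.
  have hae : g =ᵐ[volume]
      fun x => ∑ σ : Equiv.Perm (Fin N), (weylChamber N).indicator g (x ∘ σ) := by
    filter_upwards [ae_injective N] with x hx
    rw [Finset.sum_eq_single (Tuple.sort x)]
    · rw [Set.indicator_of_mem (show x ∘ Tuple.sort x ∈ weylChamber N from Tuple.monotone_sort x),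
        hsymm]
    · intro σ _ hσ
      refine Set.indicator_of_notMem (fun hmem => hσ ?_) _
      have := Tuple.unique_monotone (f := x) (σ := σ) (τ := Tuple.sort x) hmem
        (Tuple.monotone_sort x)
      exact Equiv.ext fun i => hx (congrFun this i)
    · intro h
      exact absurd (Finset.mem_univ _) h
  rw [integral_congr_ae hae, integral_finsetSum]
  · have : ∀ σ : Equiv.Perm (Fin N),
        ∫ x, (weylChamber N).indicator g (x ∘ σ) = ∫ x in weylChamber N, g x := by
      intro σ
      rw [(measurePreserving_comp_equiv σ).integral_comp (measurableEmbedding_comp_equiv σ),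
        integral_indicator hch]
    simp [this, Fintype.card_perm]
  · intro σ _
    exact (measurePreserving_comp_equiv σ).integrable_comp_of_integrable (hg.indicator hch)

/-- The volume of the ordered simplex of side `s`. -/
theorem volume_real_orderedSimplex (n : ℕ) {s : ℝ} (hs : 0 ≤ s) :
    volume.real {z : Fin n → ℝ | Monotone z ∧ ∀ i, 0 ≤ z i ∧ z i ≤ s} = s ^ n / n.factorial := by
  set Q : Set (Fin n → ℝ) := Set.univ.pi fun _ => Set.Icc 0 s with hQ
  have hQm : MeasurableSet Q := MeasurableSet.univ_pi fun _ => measurableSet_Icc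
  have hQv : volume.real Q = s ^ n := by
    rw [hQ, measureReal_def, volume_pi_pi]
    simp [hs]
  have hfin : volume Q ≠ ⊤ := by
    rw [hQ, volume_pi_pi]
    simp
  have hint : Integrable (Q.indicator (1 : (Fin n → ℝ) → ℝ)) :=
    (integrable_indicator_iff hQm).2 (integrableOn_const hfin)
  -- The indicator of the cube `[0, s]^n` is symmetric, and the part of the cube in the chamber is
  -- the simplex.
  have h := integral_eq_factorial_mul_setIntegral_weylChamber hint (fun σ x => by
    have : x ∘ σ ∈ Q ↔ x ∈ Q := by
      simp only [hQ, Set.mem_univ_pi, Function.comp_apply]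
      exact σ.forall_congr_right (q := fun i => x i ∈ Set.Icc 0 s)
    by_cases hx : x ∈ Q <;> simp [this, hx])
  rw [integral_indicator_one hQm, hQv, setIntegral_indicator hQm] at h
  have hset : {z : Fin n → ℝ | Monotone z ∧ ∀ i, 0 ≤ z i ∧ z i ≤ s} = weylChamber n ∩ Q := by
    ext z
    simp only [weylChamber, hQ, Set.mem_inter_iff, Set.mem_univ_pi, Set.mem_Icc, Set.mem_ofPred_eq]
  rw [hset, eq_div_iff (by positivity), h, mul_comm]
  simp

/-! ### The joint density -/

theorem measurable_ensembleWeight (β : DysonIndex) {V : ℝ → ℝ} (hV : Measurable V) (N : ℕ) :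
    Measurable (ensembleWeight β V N) := by
  unfold ensembleWeight
  cases β <;> simp only <;> fun_prop

theorem ensembleWeight_nonneg (β : DysonIndex) (V : ℝ → ℝ) (N : ℕ) (x : ℝ) :
    0 ≤ ensembleWeight β V N x := by
  unfold ensembleWeight
  cases β <;> exact (Real.exp_pos _).le

theorem measurable_unnormalizedDensity (β : DysonIndex) {V : ℝ → ℝ} (hV : Measurable V) (N : ℕ) :
    Measurable (unnormalizedDensity β V N) := by
  unfold unnormalizedDensity
  have := measurable_ensembleWeight β hV N
  refine Measurable.mul ?_ ?_
  · refine Finset.measurable_prod _ fun j _ => Finset.measurable_prod _ fun k _ => ?_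
    have : Measurable fun x : Fin N → ℝ => |x k - x j| := by fun_prop
    exact this.pow_const _
  · exact Finset.measurable_prod _ fun j _ => this.comp (measurable_pi_apply j)

theorem unnormalizedDensity_nonneg (β : DysonIndex) (V : ℝ → ℝ) (N : ℕ) (x : Fin N → ℝ) :
    0 ≤ unnormalizedDensity β V N x :=
  mul_nonneg (Finset.prod_nonneg fun _ _ => Finset.prod_nonneg fun _ _ => by positivity)
    (Finset.prod_nonneg fun _ _ => ensembleWeight_nonneg β V N _)

/-- The interaction factor is a power of the absolute value of a Vandermonde determinant, which a
permutation changes only by a sign. -/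
theorem unnormalizedDensity_comp_perm (β : DysonIndex) (V : ℝ → ℝ) (N : ℕ)
    (σ : Equiv.Perm (Fin N)) (x : Fin N → ℝ) :
    unnormalizedDensity β V N (x ∘ σ) = unnormalizedDensity β V N x := by
  have hv : ∀ x : Fin N → ℝ, ∏ j, ∏ k ∈ Finset.Ioi j, |x k - x j| ^ β.val =
      |(Matrix.vandermonde x).det| ^ β.val := by
    intro x
    rw [Matrix.det_vandermonde, Finset.abs_prod, ← Finset.prod_pow]
    refine Finset.prod_congr rfl fun j _ => ?_
    rw [Finset.abs_prod, ← Finset.prod_pow]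
  have hp : (Matrix.vandermonde (x ∘ σ)).det =
      ((Equiv.Perm.sign σ : ℤ) : ℝ) * (Matrix.vandermonde x).det := by
    rw [← Matrix.det_permute]
    rfl
  unfold unnormalizedDensity
  rw [hv, hv, hp]
  congr 1
  · congr 1
    rcases Int.units_eq_one_or (Equiv.Perm.sign σ) with h | h <;> simp [h]
  · exact Equiv.prod_comp σ fun j => ensembleWeight β V N (x j)

theorem integrable_one_add_abs_pow_mul_ensembleWeight (β : DysonIndex) {V : ℝ → ℝ}
    (hV : HasFiniteMoments V) {N : ℕ} (hN : 1 ≤ N) (m : ℕ) :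
    Integrable fun x : ℝ => (1 + |x|) ^ m * ensembleWeight β V N x := by
  have key : ∀ N' : ℕ, 1 ≤ N' →
      Integrable fun x : ℝ => (1 + |x|) ^ m * Real.exp (-(N' * V x)) := by
    intro N' hN'
    have e : (fun x : ℝ => (1 + |x|) ^ m * Real.exp (-(N' * V x))) = fun x =>
        ∑ i ∈ Finset.range (m + 1), (m.choose i : ℝ) * ‖x ^ (m - i) * Real.exp (-(N' * V x))‖ := by
      funext x
      rw [add_pow, Finset.sum_mul]
      refine Finset.sum_congr rfl fun i _ => ?_
      rw [norm_mul, norm_pow, Real.norm_eq_abs, Real.norm_eq_abs, Real.abs_exp]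
      ring
    rw [e]
    exact integrable_finsetSum _ fun i _ => ((hV N' hN' (m - i)).norm).const_mul _
  cases β
  · exact key N hN
  · exact key N hN
  -- For `β = 4` the weight with index `N` is `exp (-2NV)`, so the moments with index `2N` are used.
  · have := key (2 * N) (by omega)
    push_cast at this
    exact this

/-- Since `|x - y| ≤ (1 + |x|)(1 + |y|)`, the density is dominated by a product of functions of one
variable. The product over `j < k` is enlarged to all `(j, k)`; each coordinate then occurs `2N`
times, hence the exponent `2 * N * β`. -/
theorem integrable_unnormalizedDensity (β : DysonIndex) {V : ℝ → ℝ} (hVmeas : Measurable V)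
    (hV : HasFiniteMoments V) {N : ℕ} (hN : 1 ≤ N) : Integrable (unnormalizedDensity β V N) := by
  have hprod : Integrable fun x : Fin N → ℝ =>
      ∏ j, ((1 + |x j|) ^ (2 * N * β.val) * ensembleWeight β V N (x j)) :=
    Integrable.fintype_prod fun _ => integrable_one_add_abs_pow_mul_ensembleWeight β hV hN _
  refine hprod.mono' (measurable_unnormalizedDensity β hVmeas N).aestronglyMeasurable
    (Filter.Eventually.of_forall fun x => ?_)
  rw [Real.norm_of_nonneg (unnormalizedDensity_nonneg β V N x)]
  unfold unnormalizedDensity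
  rw [Finset.prod_mul_distrib]
  refine mul_le_mul_of_nonneg_right ?_ (Finset.prod_nonneg fun _ _ => ensembleWeight_nonneg β V N _)
  have h1 : ∀ y : ℝ, 1 ≤ 1 + |y| := fun y => by linarith [abs_nonneg y]
  have hfac : ∀ j k, |x k - x j| ^ β.val ≤ ((1 + |x k|) * (1 + |x j|)) ^ β.val := by
    intro j k
    refine pow_le_pow_left₀ (abs_nonneg _) ?_ _
    have := abs_sub (x k) (x j)
    nlinarith [abs_nonneg (x k), abs_nonneg (x j)]
  calc ∏ j, ∏ k ∈ Finset.Ioi j, |x k - x j| ^ β.val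
      ≤ ∏ j, ∏ k, ((1 + |x k|) * (1 + |x j|)) ^ β.val := by
        refine Finset.prod_le_prod (fun j _ => Finset.prod_nonneg fun k _ => by positivity)
          fun j _ => ?_
        rw [← Finset.univ_inter (Finset.Ioi j), ← Finset.prod_ite_mem]
        refine Finset.prod_le_prod (fun k _ => by split_ifs <;> positivity) fun k _ => ?_
        split_ifs
        · exact hfac j k
        · exact one_le_pow₀ (one_le_mul_of_one_le_of_one_le (h1 _) (h1 _))
    _ = _ := by
        simp only [mul_pow, Finset.prod_mul_distrib, Finset.prod_const, Finset.card_univ,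
          Fintype.card_fin, Finset.prod_pow]
        rw [← pow_mul, ← pow_add]
        congr 1
        ring

theorem jointDensity_nonneg (β : DysonIndex) (V : ℝ → ℝ) (N : ℕ) (x : Fin N → ℝ) :
    0 ≤ jointDensity β V N x :=
  mul_nonneg (inv_nonneg.2 (integral_nonneg fun _ => unnormalizedDensity_nonneg β V N _))
    (unnormalizedDensity_nonneg β V N x)

theorem measurable_jointDensity (β : DysonIndex) {V : ℝ → ℝ} (hV : Measurable V) (N : ℕ) :
    Measurable (jointDensity β V N) :=
  (measurable_unnormalizedDensity β hV N).const_mul _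

theorem integrable_jointDensity (β : DysonIndex) {V : ℝ → ℝ} (hVmeas : Measurable V)
    (hV : HasFiniteMoments V) {N : ℕ} (hN : 1 ≤ N) : Integrable (jointDensity β V N) :=
  (integrable_unnormalizedDensity β hVmeas hV hN).const_mul _

theorem jointDensity_comp_perm (β : DysonIndex) (V : ℝ → ℝ) (N : ℕ)
    (σ : Equiv.Perm (Fin N)) (x : Fin N → ℝ) :
    jointDensity β V N (x ∘ σ) = jointDensity β V N x := by
  rw [jointDensity, unnormalizedDensity_comp_perm, jointDensity]

theorem integral_eigenvalueLaw (β : DysonIndex) {V : ℝ → ℝ} (hV : Measurable V) (N : ℕ)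
    (F : (Fin N → ℝ) → ℝ) :
    ∫ x, F x ∂(eigenvalueLaw β V N) = ∫ x in weylChamber N, F x * jointDensity β V N x := by
  rw [eigenvalueLaw, integral_withDensity_eq_integral_toReal_smul
    (measurable_jointDensity β hV N).ennreal_ofReal
    (Filter.Eventually.of_forall fun _ => ENNReal.ofReal_lt_top)]
  refine integral_congr_ae (Filter.Eventually.of_forall fun x => ?_)
  simp only [smul_eq_mul, ENNReal.toReal_ofReal (jointDensity_nonneg β V N x)]
  ring

theorem isFiniteMeasure_eigenvalueLaw (β : DysonIndex) {V : ℝ → ℝ} (hVmeas : Measurable V)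
    (hV : HasFiniteMoments V) {N : ℕ} (hN : 1 ≤ N) : IsFiniteMeasure (eigenvalueLaw β V N) :=
  isFiniteMeasure_withDensity_ofReal
    (integrable_jointDensity β hVmeas hV hN).integrableOn.hasFiniteIntegral

/-! ### From sums over increasing tuples to correlation functions -/

/-- Index tuples that are injective but not increasing give non-monotone arguments, where `f`
vanishes. The sum over embeddings, unlike the one over increasing tuples, is symmetric in the
coordinates of `x`, as the symmetrization over the chamber requires. -/
theorem Finset.sum_strictMono_eq_sum_embedding {k N : ℕ} {f : (Fin k → ℝ) → ℝ}
    (hf : ∀ y, ¬ Monotone y → f y = 0) {x : Fin N → ℝ} (hx : StrictMono x)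
    [DecidablePred fun i : Fin k → Fin N => StrictMono i] :
    ∑ i ∈ (Finset.univ : Finset (Fin k → Fin N)).filter (fun i => StrictMono i), f (x ∘ i) =
      ∑ i : Fin k ↪ Fin N, f (x ∘ i) := by
  classical
  have h1 : ∑ i : Fin k ↪ Fin N, f (x ∘ i) =
      ∑ i ∈ (Finset.univ : Finset (Fin k ↪ Fin N)).filter
        (fun i : Fin k ↪ Fin N => StrictMono ⇑i), f (x ∘ i) := by
    symm
    refine Finset.sum_subset (Finset.filter_subset _ _) fun i _ hi => hf _ fun hmono => hi ?_
    refine Finset.mem_filter.2 ⟨Finset.mem_univ _, ?_⟩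
    have : Monotone i := fun a b hab => hx.le_iff_le.1 (hmono hab)
    exact this.strictMono_of_injective i.injective
  rw [h1]
  symm
  refine Finset.sum_bij (fun i _ => (i : Fin k → Fin N)) ?_ ?_ ?_ ?_
  · intro i hi
    simpa using hi
  · intro i _ j _ h
    exact DFunLike.coe_injective h
  · intro i hi
    have hi' : StrictMono i := (Finset.mem_filter.1 hi).2
    exact ⟨⟨i, hi'.injective⟩, by simpa using hi', rfl⟩
  · intro i _
    rfl

/-- The expectation of a sum over ordered `k`-tuples of the ordered points, as an integral over all
of space that involves the first `k` coordinates only. -/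
theorem setIntegral_weylChamber_sum_strictMono {N k : ℕ} (hk : k ≤ N) {R : (Fin N → ℝ) → ℝ}
    (hR : Integrable R) (hsymm : ∀ (σ : Equiv.Perm (Fin N)) x, R (x ∘ σ) = R x)
    {f : (Fin k → ℝ) → ℝ} (hfm : Measurable f) (hf1 : ∀ y, |f y| ≤ 1)
    (hf : ∀ y, ¬ Monotone y → f y = 0) [DecidablePred fun i : Fin k → Fin N => StrictMono i] :
    ∫ x in weylChamber N,
      (∑ i ∈ (Finset.univ : Finset (Fin k → Fin N)).filter (fun i => StrictMono i), f (x ∘ i)) *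
        R x = 1 / ((N - k).factorial : ℝ) * ∫ x, f (x ∘ Fin.castLE hk) * R x := by
  classical
  have hint : ∀ i : Fin k → Fin N, Integrable fun x : Fin N → ℝ => f (x ∘ i) * R x := by
    intro i
    have hm : Measurable fun x : Fin N → ℝ => f (x ∘ i) :=
      hfm.comp (measurable_pi_lambda _ fun j => measurable_pi_apply (i j))
    exact hR.bdd_mul hm.aestronglyMeasurable (Filter.Eventually.of_forall fun x => hf1 _)
  have hG : Integrable fun x : Fin N → ℝ => (∑ i : Fin k ↪ Fin N, f (x ∘ i)) * R x := by
    simp only [Finset.sum_mul]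
    exact integrable_finsetSum _ fun i _ => hint i
  have hGs : ∀ (σ : Equiv.Perm (Fin N)) (x : Fin N → ℝ),
      (∑ i : Fin k ↪ Fin N, f ((x ∘ σ) ∘ i)) * R (x ∘ σ) =
        (∑ i : Fin k ↪ Fin N, f (x ∘ i)) * R x := by
    intro σ x
    rw [hsymm]
    congr 1
    exact Fintype.sum_equiv (Equiv.embeddingCongr (Equiv.refl _) σ) _ _ fun i => rfl
  have h1 : ∫ x in weylChamber N,
      (∑ i ∈ (Finset.univ : Finset (Fin k → Fin N)).filter (fun i => StrictMono i), f (x ∘ i)) *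
        R x = ∫ x in weylChamber N, (∑ i : Fin k ↪ Fin N, f (x ∘ i)) * R x := by
    refine setIntegral_congr_ae (measurableSet_weylChamber N) ?_
    filter_upwards [ae_injective N] with x hx hch
    rw [Finset.sum_strictMono_eq_sum_embedding hf
      (Monotone.strictMono_of_injective (show Monotone x from hch) hx)]
  -- Some permutation carries the first `k` indices to the tuple `i`, and `R` is symmetric, so all
  -- embeddings contribute equally.
  have h2 : ∀ i : Fin k ↪ Fin N,
      ∫ x, f (x ∘ i) * R x = ∫ x, f (x ∘ Fin.castLE hk) * R x := by
    intro i
    have := Equiv.Perm.isMultiplyPretransitive (Fin N) k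
    obtain ⟨σ, hσ⟩ := MulAction.exists_smul_eq (Equiv.Perm (Fin N)) (Fin.castLEEmb hk) i
    have hσ' : ∀ x : Fin N → ℝ, x ∘ i = (x ∘ σ) ∘ Fin.castLE hk := by
      intro x
      rw [← hσ]
      rfl
    rw [← (measurePreserving_comp_equiv σ).integral_comp (measurableEmbedding_comp_equiv σ)
      (fun x => f (x ∘ Fin.castLE hk) * R x)]
    simp only [hσ', hsymm]
  have h3 := integral_eq_factorial_mul_setIntegral_weylChamber hG hGs
  have h4 : ∫ x : Fin N → ℝ, (∑ i : Fin k ↪ Fin N, f (x ∘ i)) * R x =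
      N.descFactorial k * ∫ x, f (x ∘ Fin.castLE hk) * R x := by
    simp only [Finset.sum_mul]
    rw [integral_finsetSum Finset.univ fun (i : Fin k ↪ Fin N) _ => hint i]
    simp [h2, Fintype.card_embedding_eq]
  rw [h4] at h3
  -- There are `N! / (N-k)!` embeddings; divided by the `N!` of the symmetrization they leave the
  -- prefactor of the correlation function.
  have hfac : ((N - k).factorial : ℝ) * N.descFactorial k = N.factorial := by
    exact_mod_cast Nat.factorial_mul_descFactorial hk
  rw [h1]
  have hN0 : (N.factorial : ℝ) ≠ 0 := by positivity
  have hd0 : (N.descFactorial k : ℝ) ≠ 0 := by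
    intro h; rw [h, mul_zero] at hfac; exact hN0 hfac.symm
  rw [← hfac, mul_comm ((N - k).factorial : ℝ), mul_assoc] at h3
  have h5 := mul_left_cancel₀ hd0 h3
  rw [h5]
  field_simp

/-- The splitting of the indices of `Fin N` into the first `k` and the last `N - k`. -/
def splitEquiv {N k : ℕ} (hk : k ≤ N) : Fin k ⊕ Fin (N - k) ≃ Fin N :=
  finSumFinEquiv.trans (finCongr (by omega))

theorem joinVec_eq {N k : ℕ} (hk : k ≤ N) (p : (Fin k → ℝ) × (Fin (N - k) → ℝ)) :
    joinVec p.1 p.2 = (MeasurableEquiv.sumPiEquivProdPi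
      (fun _ : Fin k ⊕ Fin (N - k) => ℝ)).symm p ∘ (splitEquiv hk).symm := by
  funext i
  obtain ⟨j, rfl⟩ := (splitEquiv hk).surjective i
  rw [Function.comp_apply, Equiv.symm_apply_apply, MeasurableEquiv.coe_sumPiEquivProdPi_symm]
  cases j with
  | inl j => simp [joinVec, splitEquiv, Equiv.sumPiEquivProdPi]
  | inr j => simp [joinVec, splitEquiv, Equiv.sumPiEquivProdPi]

theorem measurePreserving_joinVec {N k : ℕ} (hk : k ≤ N) :
    MeasurePreserving (fun p : (Fin k → ℝ) × (Fin (N - k) → ℝ) => (joinVec p.1 p.2 : Fin N → ℝ))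
      volume volume := by
  have e : (fun p : (Fin k → ℝ) × (Fin (N - k) → ℝ) => (joinVec p.1 p.2 : Fin N → ℝ)) =
      (fun x => x ∘ (splitEquiv hk).symm) ∘
        (MeasurableEquiv.sumPiEquivProdPi (fun _ : Fin k ⊕ Fin (N - k) => ℝ)).symm :=
    funext fun p => joinVec_eq hk p
  rw [e]
  exact (measurePreserving_comp_equiv (splitEquiv hk).symm).comp
    (volume_measurePreserving_sumPiEquivProdPi_symm _)

theorem measurableEmbedding_joinVec {N k : ℕ} (hk : k ≤ N) :
    MeasurableEmbedding
      (fun p : (Fin k → ℝ) × (Fin (N - k) → ℝ) => (joinVec p.1 p.2 : Fin N → ℝ)) := by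
  have e : (fun p : (Fin k → ℝ) × (Fin (N - k) → ℝ) => (joinVec p.1 p.2 : Fin N → ℝ)) =
      (fun x => x ∘ (splitEquiv hk).symm) ∘
        (MeasurableEquiv.sumPiEquivProdPi (fun _ : Fin k ⊕ Fin (N - k) => ℝ)).symm :=
    funext fun p => joinVec_eq hk p
  rw [e]
  exact (measurableEmbedding_comp_equiv (splitEquiv hk).symm).comp
    (MeasurableEquiv.measurableEmbedding _)

theorem joinVec_comp_castLE {N k : ℕ} (hk : k ≤ N) (y : Fin k → ℝ) (z : Fin (N - k) → ℝ) :
    (joinVec y z : Fin N → ℝ) ∘ Fin.castLE hk = y := by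
  funext i
  simp [joinVec]

theorem integral_comp_castLE_mul {N k : ℕ} (hk : k ≤ N) {R : (Fin N → ℝ) → ℝ}
    (hR : Integrable R) {f : (Fin k → ℝ) → ℝ} (hfm : Measurable f) (hf1 : ∀ y, |f y| ≤ 1) :
    ∫ x, f (x ∘ Fin.castLE hk) * R x =
      ∫ y, f y * ∫ z : Fin (N - k) → ℝ, R (joinVec y z) := by
  have hm : Measurable fun x : Fin N → ℝ => f (x ∘ Fin.castLE hk) :=
    hfm.comp (measurable_pi_lambda _ fun j => measurable_pi_apply _)
  have hint : Integrable fun x : Fin N → ℝ => f (x ∘ Fin.castLE hk) * R x :=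
    hR.bdd_mul hm.aestronglyMeasurable (Filter.Eventually.of_forall fun x => hf1 _)
  have hint' := (measurePreserving_joinVec hk).integrable_comp_of_integrable hint
  rw [← (measurePreserving_joinVec hk).integral_comp (measurableEmbedding_joinVec hk)]
  rw [Measure.volume_eq_prod] at hint' ⊢
  refine (integral_prod _ hint').trans ?_
  simp only [Function.comp_apply, joinVec_comp_castLE, integral_const_mul]

theorem integral_comp_unscale {k : ℕ} {ρ a : ℝ} {N : ℕ} (hc : 0 < (N : ℝ) * ρ)
    (F : (Fin k → ℝ) → ℝ) :
    ∫ t : Fin k → ℝ, F (fun i => unscale ρ a N (t i)) = ((N : ℝ) * ρ) ^ k * ∫ y, F y := by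
  have e : (fun t : Fin k → ℝ => F (fun i => unscale ρ a N (t i))) =
      fun t => (fun y => F ((fun _ => a) + y)) (((N : ℝ) * ρ)⁻¹ • t) := by
    funext t
    congr 1
    funext i
    simp [unscale, div_eq_inv_mul]
  rw [e, Measure.integral_comp_smul volume (fun y => F ((fun _ => a) + y)),
    integral_add_left_eq_self]
  simp only [Module.finrank_fintype_fun_eq_card, Fintype.card_fin, smul_eq_mul]
  congr 1
  rw [inv_pow, inv_inv, abs_of_pos (by positivity)]

theorem integrable_comp_unscale {k : ℕ} {ρ a : ℝ} {N : ℕ} (hc : 0 < (N : ℝ) * ρ)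
    {F : (Fin k → ℝ) → ℝ} (hF : Integrable F) :
    Integrable fun t : Fin k → ℝ => F (fun i => unscale ρ a N (t i)) := by
  have e : (fun t : Fin k → ℝ => F (fun i => unscale ρ a N (t i))) =
      fun t => (fun y => F ((fun _ => a) + y)) (((N : ℝ) * ρ)⁻¹ • t) := by
    funext t
    congr 1
    funext i
    simp [unscale, div_eq_inv_mul]
  rw [e]
  exact (hF.comp_add_left _).comp_smul (inv_ne_zero hc.ne')

section Correlation

variable {β : DysonIndex} {V : ℝ → ℝ} {ρ a : ℝ} {N k : ℕ}

theorem integrable_correlation (hVmeas : Measurable V) (hV : HasFiniteMoments V) (hN : 1 ≤ N)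
    (hk : k ≤ N) : Integrable (correlation β V N k) := by
  have h := (measurePreserving_joinVec hk).integrable_comp_of_integrable
    (integrable_jointDensity β hVmeas hV hN)
  rw [Measure.volume_eq_prod] at h
  exact h.integral_prod_left.const_mul _

theorem integrable_rescaledCorrelation (hVmeas : Measurable V) (hV : HasFiniteMoments V)
    (hN : 1 ≤ N) (hk : k ≤ N) (hc : 0 < (N : ℝ) * ρ) :
    Integrable (rescaledCorrelation β V ρ a N k) :=
  (integrable_comp_unscale hc (integrable_correlation hVmeas hV hN hk)).const_mul _

theorem setIntegral_sum_strictMono_mul_jointDensity (hVmeas : Measurable V)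
    (hV : HasFiniteMoments V) (hN : 1 ≤ N) (hk : k ≤ N) (hc : 0 < (N : ℝ) * ρ)
    {f : (Fin k → ℝ) → ℝ} (hfm : Measurable f) (hf1 : ∀ y, |f y| ≤ 1)
    (hf : ∀ y, ¬ Monotone y → f y = 0) [DecidablePred fun i : Fin k → Fin N => StrictMono i] :
    ∫ x in weylChamber N,
      (∑ i ∈ (Finset.univ : Finset (Fin k → Fin N)).filter (fun i => StrictMono i), f (x ∘ i)) *
        jointDensity β V N x =
      ∫ t, f (fun i => unscale ρ a N (t i)) * rescaledCorrelation β V ρ a N k t := by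
  have hR := integrable_jointDensity β hVmeas hV hN
  rw [setIntegral_weylChamber_sum_strictMono hk hR (jointDensity_comp_perm β V N) hfm hf1 hf,
    integral_comp_castLE_mul hk hR hfm hf1]
  have e : ∀ t : Fin k → ℝ, f (fun i => unscale ρ a N (t i)) * rescaledCorrelation β V ρ a N k t =
      (fun y => ((N * ρ) ^ k)⁻¹ * (1 / ((N - k).factorial : ℝ)) *
        (f y * ∫ z : Fin (N - k) → ℝ, jointDensity β V N (joinVec y z)))
        (fun i => unscale ρ a N (t i)) := by
    intro t
    simp only [rescaledCorrelation, correlation]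
    ring
  simp only [e]
  rw [integral_comp_unscale hc (fun y => ((N * ρ) ^ k)⁻¹ * (1 / ((N - k).factorial : ℝ)) *
        (f y * ∫ z : Fin (N - k) → ℝ, jointDensity β V N (joinVec y z))), integral_const_mul]
  field_simp

end Correlation

/-! ### The window -/

section Window

variable {ρ a : ℝ} {δ : ℕ → ℝ} {N : ℕ}

theorem rescale_unscale (hc : 0 < (N : ℝ) * ρ) (t : ℝ) : rescale ρ a N (unscale ρ a N t) = t := by
  unfold rescale unscale
  have := hc.ne'
  rw [add_sub_cancel_left, div_mul_cancel₀ _ this]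

theorem rescale_injective (hc : 0 < (N : ℝ) * ρ) : Function.Injective (rescale ρ a N) := by
  intro x y h
  unfold rescale at h
  have := mul_right_cancel₀ hc.ne' h
  linarith

theorem rescale_mono (hc : 0 < (N : ℝ) * ρ) : Monotone (rescale ρ a N) := by
  intro x y h
  unfold rescale
  exact mul_le_mul_of_nonneg_right (by linarith) hc.le

theorem rescaledWindow_eq (hc : 0 < (N : ℝ) * ρ) :
    rescaledWindow ρ a δ N = Set.Icc (-(N * ρ * δ N)) (N * ρ * δ N) := by
  ext t
  constructor
  · rintro ⟨x, ⟨h1, h2⟩, rfl⟩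
    unfold rescale
    constructor <;> nlinarith
  · rintro ⟨h1, h2⟩
    refine ⟨unscale ρ a N t, ?_, rescale_unscale hc t⟩
    unfold unscale window
    rw [Set.mem_Icc]
    have h3 : -(δ N) ≤ t / (N * ρ) := by rw [le_div_iff₀ hc]; linarith
    have h4 : t / (N * ρ) ≤ δ N := by rw [div_le_iff₀ hc]; linarith
    constructor <;> linarith

theorem windowLength_eq (hc : 0 < (N : ℝ) * ρ) (hδ : 0 < δ N) :
    windowLength ρ a δ N = 2 * (N * ρ * δ N) := by
  have : 0 < N * ρ * δ N := mul_pos hc hδ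
  rw [windowLength, rescaledWindow_eq hc, Real.volume_real_Icc_of_le (by linarith)]
  ring

theorem mem_window_iff (hc : 0 < (N : ℝ) * ρ) (x : ℝ) :
    rescale ρ a N x ∈ rescaledWindow ρ a δ N ↔ x ∈ window a δ N :=
  (rescale_injective hc).mem_set_image

/-- Monotone tuples in the rescaled window of diameter at most `s`. -/
def clusterRegion (ρ a : ℝ) (δ : ℕ → ℝ) (N n : ℕ) (s : ℝ) : Set (Fin (n + 1) → ℝ) :=
  {t | Monotone t ∧ t 0 ∈ rescaledWindow ρ a δ N ∧ t (Fin.last n) ∈ rescaledWindow ρ a δ N ∧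
    t (Fin.last n) - t 0 ≤ s}

theorem measurableSet_clusterRegion (hc : 0 < (N : ℝ) * ρ) (n : ℕ) (s : ℝ) :
    MeasurableSet (clusterRegion ρ a δ N n s) := by
  have e : clusterRegion ρ a δ N n s = {t | Monotone t} ∩
      ((fun t => t 0) ⁻¹' (rescaledWindow ρ a δ N) ∩
        ((fun t => t (Fin.last n)) ⁻¹' (rescaledWindow ρ a δ N) ∩
          {t | t (Fin.last n) - t 0 ≤ s})) := rfl
  have hW : MeasurableSet (rescaledWindow ρ a δ N) := by
    rw [rescaledWindow_eq hc]
    exact measurableSet_Icc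
  rw [e]
  have hap : ∀ i : Fin (n + 1), Measurable fun t : Fin (n + 1) → ℝ => t i := measurable_pi_apply
  exact (measurableSet_setOf_monotone _).inter ((hap _ hW).inter
    ((hap _ hW).inter (measurableSet_le ((hap _).sub (hap _)) measurable_const)))

/-- For ordered points an increasing tuple has a nonnegative end-to-end difference. Monotonicity is
part of the region so that its indicator vanishes off monotone tuples, as the passage to embeddings
demands. -/
theorem clusterMeasure_real_eq (hc : 0 < (N : ℝ) * ρ) (n : ℕ) (s : ℝ) {x : Fin N → ℝ}
    (hx : Monotone x) [DecidablePred fun i : Fin (n + 1) → Fin N => StrictMono i] :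
    (clusterMeasure ρ a δ N (n + 1) x).real (Set.Icc 0 s) =
      1 / windowLength ρ a δ N *
        ∑ i ∈ (Finset.univ : Finset (Fin (n + 1) → Fin N)).filter (fun i => StrictMono i),
          (clusterRegion ρ a δ N n s).indicator (fun _ => (1 : ℝ))
            (fun j => rescale ρ a N (x (i j))) := by
  classical
  have hL : 0 ≤ 1 / windowLength ρ a δ N := one_div_nonneg.2 measureReal_nonneg
  rw [clusterMeasure, measureReal_def, Measure.smul_apply, Measure.finsetSum_apply, smul_eq_mul,
    ENNReal.toReal_mul, ENNReal.toReal_ofReal hL, ENNReal.toReal_sum (by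
      intro i _
      exact measure_ne_top _ _)]
  congr 1
  rw [Finset.sum_filter, Finset.sum_filter]
  refine Finset.sum_congr rfl fun i _ => ?_
  by_cases hi : StrictMono i
  · have hmono : Monotone fun j => rescale ρ a N (x (i j)) := fun p q hpq =>
      rescale_mono hc (hx (hi.monotone hpq))
    have h0 : 0 ≤ rescale ρ a N (x (i (Fin.last n))) - rescale ρ a N (x (i 0)) :=
      sub_nonneg.2 (hmono (Fin.zero_le _))
    rw [Measure.dirac_apply' _ measurableSet_Icc]
    simp only [hi, true_and, if_true, Set.indicator_apply, clusterRegion, Set.mem_ofPred_eq, hmono,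
      Set.mem_Icc, h0, Pi.one_apply]
    split_ifs <;> simp_all
  · simp [hi]

theorem expectedCluster_eq {β : DysonIndex} {V : ℝ → ℝ} (hVmeas : Measurable V)
    (hV : HasFiniteMoments V) {n : ℕ} (hn : n + 1 ≤ N) (hc : 0 < (N : ℝ) * ρ) (s : ℝ) :
    expectedCluster β V ρ a δ N (n + 1) s = 1 / windowLength ρ a δ N *
      ∫ t in clusterRegion ρ a δ N n s, rescaledCorrelation β V ρ a N (n + 1) t := by
  classical
  have hm := measurableSet_clusterRegion (a := a) (δ := δ) hc n s
  set f : (Fin (n + 1) → ℝ) → ℝ := fun y =>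
    (clusterRegion ρ a δ N n s).indicator (fun _ => (1 : ℝ)) (fun j => rescale ρ a N (y j)) with hf
  have hfm : Measurable f := by
    refine (measurable_const.indicator hm).comp (measurable_pi_lambda _ fun j => ?_)
    have : Measurable (rescale ρ a N) := by unfold rescale; fun_prop
    exact this.comp (measurable_pi_apply j)
  have hf1 : ∀ y, |f y| ≤ 1 := by
    intro y
    simp only [hf, Set.indicator_apply]
    split_ifs <;> simp
  have hf0 : ∀ y, ¬ Monotone y → f y = 0 := by
    intro y hy
    refine Set.indicator_of_notMem (fun hmem => hy fun i j hij => ?_) _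
    have h1 := hmem.1 hij
    simp only [rescale] at h1
    have := le_of_mul_le_mul_right h1 hc
    linarith
  rw [expectedCluster, integral_eigenvalueLaw β hVmeas]
  have h1 : ∫ x in weylChamber N, (clusterMeasure ρ a δ N (n + 1) x).real (Set.Icc 0 s) *
      jointDensity β V N x = ∫ x in weylChamber N, 1 / windowLength ρ a δ N *
      ((∑ i ∈ (Finset.univ : Finset (Fin (n + 1) → Fin N)).filter (fun i => StrictMono i),
        f (x ∘ i)) * jointDensity β V N x) := by
    refine setIntegral_congr_fun (measurableSet_weylChamber N) fun x hx => ?_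
    rw [clusterMeasure_real_eq hc n s hx, mul_assoc]
    rfl
  rw [h1, integral_const_mul,
    setIntegral_sum_strictMono_mul_jointDensity (ρ := ρ) (a := a) hVmeas hV (by omega) hn hc hfm
      hf1 hf0, ← integral_indicator hm]
  congr 1
  refine integral_congr_ae (Filter.Eventually.of_forall fun t => ?_)
  simp only [hf, rescale_unscale hc, Set.indicator_apply]
  split_ifs <;> simp

end Window

/-! ### Comparison of the expected cluster counts with their limits -/

/-- Coordinates on `ℝ^(n+1)`: the first coordinate, and the differences to it. -/
def shearEquiv (n : ℕ) : ℝ × (Fin n → ℝ) ≃ᵐ (Fin (n + 1) → ℝ) where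
  toFun p := Fin.cons p.1 fun i => p.1 + p.2 i
  invFun t := (t 0, fun i => t i.succ - t 0)
  left_inv p := by simp
  right_inv t := by
    funext i
    cases i using Fin.cases <;> simp
  measurable_toFun := by
    refine measurable_pi_lambda _ fun i => ?_
    cases i using Fin.cases with
    | zero => exact measurable_fst
    | succ i =>
      have : Measurable fun p : ℝ × (Fin n → ℝ) => p.1 + p.2 i := by fun_prop
      exact this
  measurable_invFun := by
    refine Measurable.prodMk (measurable_pi_apply 0) (measurable_pi_lambda _ fun i => ?_)
    exact (measurable_pi_apply _).sub (measurable_pi_apply _)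

theorem shearEquiv_apply (n : ℕ) (p : ℝ × (Fin n → ℝ)) :
    shearEquiv n p = Fin.cons p.1 fun i => p.1 + p.2 i := rfl

/-- For a fixed first coordinate the map translates the others, and translations preserve volume. -/
theorem measurePreserving_shearEquiv (n : ℕ) : MeasurePreserving (shearEquiv n) := by
  have h1 : MeasurePreserving (fun p : ℝ × (Fin n → ℝ) => (p.1, (fun _ => p.1) + p.2))
      (volume.prod volume) (volume.prod volume) :=
    (MeasurePreserving.id (volume : Measure ℝ)).skew_product
      (g := fun u z => (fun _ => u) + z) (by
        refine measurable_pi_lambda _ fun i => ?_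
        have : Measurable fun p : ℝ × (Fin n → ℝ) => p.1 + p.2 i := by fun_prop
        exact this)
      (Filter.Eventually.of_forall fun u => map_add_left_eq_self _ _)
  have h2 := (volume_preserving_piFinSuccAbove (fun _ : Fin (n + 1) => ℝ) 0).symm
  rw [Measure.volume_eq_prod] at h2 ⊢
  have e : ⇑(shearEquiv n) = ⇑(MeasurableEquiv.piFinSuccAbove (fun _ : Fin (n + 1) => ℝ) 0).symm ∘
      fun p : ℝ × (Fin n → ℝ) => (p.1, (fun _ => p.1) + p.2) := by
    funext p
    rw [shearEquiv_apply, Function.comp_apply, MeasurableEquiv.piFinSuccAbove_symm_apply]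
    funext i
    cases i using Fin.cases <;> simp
  rw [e]
  exact h2.comp h1

/-- The ordered simplex of side `s`. -/
def orderedSimplex (n : ℕ) (s : ℝ) : Set (Fin n → ℝ) :=
  {z | Monotone z ∧ ∀ i, 0 ≤ z i ∧ z i ≤ s}

theorem volume_orderedSimplex_ne_top (n : ℕ) (s : ℝ) : volume (orderedSimplex n s) ≠ ⊤ := by
  refine measure_ne_top_of_subset (s := Set.univ.pi fun _ => Set.Icc 0 s)
    (fun z hz => Set.mem_univ_pi.2 fun i => hz.2 i) ?_
  rw [volume_pi_pi]
  simp

theorem orderedIntegral_succ (β : DysonIndex) (n : ℕ) (s : ℝ) :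
    orderedIntegral β (n + 1) s =
      ∫ z in orderedSimplex n s, limitCorrelation β (n + 1) (Fin.cons 0 z) := rfl

theorem abs_orderedIntegral_le (β : DysonIndex) (n : ℕ) {s : ℝ} (hs : 0 ≤ s) :
    |orderedIntegral β (n + 1) s| ≤
      10 ^ (n + 1) * ((n + 1 : ℕ) : ℝ) ^ (((n + 1 : ℕ) : ℝ) / 2) * (s ^ n / n.factorial) := by
  rw [orderedIntegral_succ, ← volume_real_orderedSimplex n hs]
  exact norm_setIntegral_le_of_norm_le_const (volume_orderedSimplex_ne_top n s).lt_top
    fun z _ => (Real.norm_eq_abs _).trans_le (abs_limitCorrelation_le β (n + 1) (Fin.cons 0 z))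

section Window

variable {ρ a : ℝ} {δ : ℕ → ℝ} {N : ℕ}

theorem preimage_clusterRegion_subset (n : ℕ) (s : ℝ) :
    shearEquiv n ⁻¹' clusterRegion ρ a δ N n s ⊆ rescaledWindow ρ a δ N ×ˢ orderedSimplex n s := by
  rintro ⟨u, z⟩ ⟨hmono, h0, _, hs⟩
  rw [shearEquiv_apply] at hmono h0 hs
  refine ⟨h0, fun i j hij => ?_, fun i => ⟨?_, ?_⟩⟩
  · have := hmono (Fin.succ_le_succ_iff.2 hij)
    simpa using this
  · have := hmono (Fin.zero_le i.succ)
    simpa using this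
  · have := hmono (Fin.le_last i.succ)
    simp only [Fin.cons_succ] at this
    simp only [Fin.cons_zero] at hs
    linarith

/-- If the smallest coordinate `u` is more than `s` below the right end of the window, then `u` plus
any point of the simplex remains in the window. Only a layer of width `s` can be lost. -/
theorem diff_preimage_clusterRegion_subset (hc : 0 < (N : ℝ) * ρ) {n : ℕ} {s : ℝ}
    (hs : 0 ≤ s) : (rescaledWindow ρ a δ N ×ˢ orderedSimplex n s) \
      shearEquiv n ⁻¹' clusterRegion ρ a δ N n s ⊆
      Set.Icc (N * ρ * δ N - s) (N * ρ * δ N) ×ˢ orderedSimplex n s := by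
  rintro ⟨u, z⟩ ⟨⟨hu, hz⟩, hn⟩
  refine ⟨⟨?_, ?_⟩, hz⟩
  · by_contra hlt
    rw [not_le] at hlt
    apply hn
    have hmono : Monotone (shearEquiv n (u, z)) := by
      rw [shearEquiv_apply]
      intro i j hij
      cases j using Fin.cases with
      | zero => rw [Fin.le_zero_iff.1 hij]
      | succ j =>
        cases i using Fin.cases with
        | zero => simpa using (hz.2 j).1
        | succ i => simpa using hz.1 (Fin.succ_le_succ_iff.1 hij)
    have hlast : (shearEquiv n (u, z)) (Fin.last n) ≤ u + s := by
      rw [shearEquiv_apply]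
      -- For `n = 0` the last coordinate is `u` itself, and the bound reduces to `0 ≤ s`.
      cases n with
      | zero => simpa using hs
      | succ n =>
        rw [← Fin.succ_last, Fin.cons_succ]
        simpa using (hz.2 (Fin.last n)).2
    have h0 : (shearEquiv n (u, z)) 0 = u := rfl
    have h0last := hmono (Fin.zero_le (Fin.last n))
    simp only at hu hlt
    refine ⟨hmono, hu, ?_, by rw [h0]; linarith⟩
    rw [rescaledWindow_eq hc, Set.mem_Icc] at hu ⊢
    rw [h0] at h0last
    constructor <;> linarith [hu.1]
  · simp only at hu
    rw [rescaledWindow_eq hc] at hu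
    exact hu.2

theorem abs_expectedCluster_sub_le {β : DysonIndex} {V : ℝ → ℝ} (hVmeas : Measurable V)
    (hV : HasFiniteMoments V) {n : ℕ} (hn : n + 1 ≤ N) (hc : 0 < (N : ℝ) * ρ) (hδ : 0 < δ N)
    {s : ℝ} (hs : 0 ≤ s) {D : ℝ} (hD : ∀ t : Fin (n + 1) → ℝ, (∀ i, t i ∈ rescaledWindow ρ a δ N) →
      |rescaledCorrelation β V ρ a N (n + 1) t - limitCorrelation β (n + 1) t| ≤ D) :
    |expectedCluster β V ρ a δ N (n + 1) s - orderedIntegral β (n + 1) s| ≤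
      1 / windowLength ρ a δ N *
        (10 ^ (n + 1) * ((n + 1 : ℕ) : ℝ) ^ (((n + 1 : ℕ) : ℝ) / 2) * (s * (s ^ n / n.factorial))) +
      D * (s ^ n / n.factorial) := by
  set L := N * ρ * δ N with hL
  have hLpos : 0 < L := mul_pos hc hδ
  set W : (Fin (n + 1) → ℝ) → ℝ := limitCorrelation β (n + 1) with hW
  set B := rescaledCorrelation β V ρ a N (n + 1) with hB
  set A := rescaledWindow ρ a δ N with hA
  have hAeq : A = Set.Icc (-L) L := rescaledWindow_eq hc
  set T := orderedSimplex n s with hT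
  set S' := shearEquiv n ⁻¹' clusterRegion ρ a δ N n s with hS'
  have hlen : windowLength ρ a δ N = 2 * L := windowLength_eq hc hδ
  have hAvol : volume.real A = 2 * L := hlen
  have hTvol : volume.real T = s ^ n / n.factorial := volume_real_orderedSimplex n hs
  have hprod : ∀ I : Set ℝ, volume.real (I ×ˢ T) = volume.real I * (s ^ n / n.factorial) := by
    intro I
    rw [Measure.volume_eq_prod, measureReal_prod_prod, hTvol]
  have hprodfin : ∀ b c : ℝ, volume (Set.Icc b c ×ˢ T) ≠ ⊤ := by
    intro b c
    rw [Measure.volume_eq_prod, Measure.prod_prod]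
    exact ENNReal.mul_ne_top measure_Icc_lt_top.ne (volume_orderedSimplex_ne_top n s)
  have hPfin : volume (A ×ˢ T) ≠ ⊤ := by rw [hAeq]; exact hprodfin _ _
  have hSm : MeasurableSet S' :=
    (shearEquiv n).measurable (measurableSet_clusterRegion hc n s)
  have hsub : S' ⊆ A ×ˢ T := preimage_clusterRegion_subset n s
  set h : ℝ × (Fin n → ℝ) → ℝ := fun p => W (Fin.cons 0 p.2) with hh
  have hWh : ∀ p, W (shearEquiv n p) = h p := by
    intro p
    rw [hh, hW]
    simp only
    rw [← limitCorrelation_add_const β (n + 1) (Fin.cons 0 p.2) p.1, shearEquiv_apply]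
    congr 1
    funext i
    cases i using Fin.cases <;> simp
  have hhb : ∀ p, ‖h p‖ ≤ 10 ^ (n + 1) * ((n + 1 : ℕ) : ℝ) ^ (((n + 1 : ℕ) : ℝ) / 2) := fun p =>
    abs_limitCorrelation_le β (n + 1) _
  have hhint : IntegrableOn h (A ×ˢ T) := by
    refine Measure.integrableOn_of_bounded hPfin ?_ (Filter.Eventually.of_forall hhb)
    have : h = fun p => W (shearEquiv n p) := funext fun p => (hWh p).symm
    rw [this]
    exact ((measurable_limitCorrelation β (n + 1)).comp
      (shearEquiv n).measurable).aestronglyMeasurable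
  have hBint : Integrable fun p => B (shearEquiv n p) :=
    (measurePreserving_shearEquiv n).integrable_comp_of_integrable
      (integrable_rescaledCorrelation hVmeas hV (by omega) hn hc)
  have hO : ∫ p in A ×ˢ T, h p = 2 * L * orderedIntegral β (n + 1) s := by
    rw [orderedIntegral_succ, Measure.volume_eq_prod]
    have hmul := setIntegral_prod_mul (μ := (volume : Measure ℝ))
      (ν := (volume : Measure (Fin n → ℝ))) (fun _ => (1 : ℝ)) (fun z => W (Fin.cons 0 z)) A T
    simp only [one_mul] at hmul
    rw [hh]
    simp only
    rw [hmul]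
    congr 1
    simp [hAvol]
  have hE : ∫ t in clusterRegion ρ a δ N n s, B t = ∫ p in S', B (shearEquiv n p) :=
    ((measurePreserving_shearEquiv n).setIntegral_preimage_emb
      (shearEquiv n).measurableEmbedding B _).symm
  rw [expectedCluster_eq hVmeas hV hn hc, hlen, hE]
  -- Main term, kernel error and boundary layer. By translation invariance the main term is exactly
  -- the length of the window times the ordered integral.
  have hsplit : ∫ p in S', B (shearEquiv n p) = 2 * L * orderedIntegral β (n + 1) s +
      (∫ p in S', (B (shearEquiv n p) - h p)) - ∫ p in (A ×ˢ T) \ S', h p := by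
    rw [setIntegral_sdiff hSm hhint hsub, hO,
      integral_sub hBint.integrableOn (hhint.mono_set hsub)]
    ring
  have hb1 : |∫ p in S', (B (shearEquiv n p) - h p)| ≤ D * (2 * L * (s ^ n / n.factorial)) := by
    have hD0 : 0 ≤ D := by
      refine (abs_nonneg _).trans (hD (fun _ => 0) fun _ => ?_)
      rw [hAeq]
      constructor <;> linarith
    have hfin : volume S' < ⊤ := (measure_mono hsub).trans_lt hPfin.lt_top
    refine (norm_setIntegral_le_of_norm_le_const (C := D)
      (f := fun p => B (shearEquiv n p) - h p) hfin fun p hp => ?_).trans ?_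
    · rw [← hWh, Real.norm_eq_abs]
      refine hD _ fun i => ?_
      -- The region constrains only the two end coordinates; by monotonicity those in between lie in
      -- the interval as well, as the kernel estimate requires.
      obtain ⟨hmono, h0, hl, _⟩ := hp
      change _ ∈ A at h0 hl
      rw [hAeq, Set.mem_Icc] at h0 hl ⊢
      exact ⟨h0.1.trans (hmono (Fin.zero_le i)), (hmono (Fin.le_last i)).trans hl.2⟩
    · refine mul_le_mul_of_nonneg_left ?_ hD0
      rw [← hAvol, ← hprod]
      exact measureReal_mono hsub hPfin
  have hb2 : |∫ p in (A ×ˢ T) \ S', h p| ≤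
      10 ^ (n + 1) * ((n + 1 : ℕ) : ℝ) ^ (((n + 1 : ℕ) : ℝ) / 2) * (s * (s ^ n / n.factorial)) := by
    have hsub2 := diff_preimage_clusterRegion_subset (a := a) (δ := δ) hc (n := n) hs
    refine (norm_setIntegral_le_of_norm_le_const (f := h) ((measure_mono hsub2).trans_lt
      (hprodfin _ _).lt_top) fun p _ => hhb p).trans ?_
    refine mul_le_mul_of_nonneg_left ((measureReal_mono hsub2 (hprodfin _ _)).trans ?_)
      (by positivity)
    rw [hprod, Real.volume_real_Icc_of_le (by linarith)]
    exact (by ring : _ = _).le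
  rw [hsplit]
  have e : 1 / (2 * L) * (2 * L * orderedIntegral β (n + 1) s +
      (∫ p in S', (B (shearEquiv n p) - h p)) - ∫ p in (A ×ˢ T) \ S', h p) -
      orderedIntegral β (n + 1) s = 1 / (2 * L) * (∫ p in S', (B (shearEquiv n p) - h p)) -
      1 / (2 * L) * ∫ p in (A ×ˢ T) \ S', h p := by
    field_simp
    ring
  rw [e]
  refine (abs_sub _ _).trans ?_
  have hL0 : 0 ≤ 1 / (2 * L) := by positivity
  rw [abs_mul, abs_mul, abs_of_nonneg hL0, add_comm]
  refine add_le_add (mul_le_mul_of_nonneg_left hb2 hL0) ?_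
  refine (mul_le_mul_of_nonneg_left hb1 hL0).trans_eq ?_
  field_simp

end Window

theorem exists_abs_expectedCluster_sub_orderedIntegral_le {β : DysonIndex} {V : ℝ → ℝ}
    (hVmeas : Measurable V) (hV : HasFiniteMoments V) {ρ a : ℝ} (hρ : 0 < ρ) {δ κ : ℕ → ℝ}
    (hδ : ∀ N, 0 < δ N) (hκ : Tendsto κ atTop (𝓝 0)) (hK : KernelsConverge β V ρ a δ κ) :
    ∃ C : ℝ, 0 < C ∧ ∀ N k : ℕ, 2 ≤ k → k ≤ N → ∀ s : ℝ, 0 ≤ s →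
      |expectedCluster β V ρ a δ N k s - orderedIntegral β k s| ≤
        1 / ((k - 1).factorial : ℝ) * s ^ k * (1 / windowLength ρ a δ N) * C ^ k
            * (k : ℝ) ^ ((k : ℝ) / 2)
          + s ^ (k - 1) * C ^ k * |κ N| := by
  obtain ⟨C, hC, hCb⟩ := exists_abs_rescaledCorrelation_sub_le hκ hK
  -- The factor 10 comes from the bound on `W_k`, and `C ≥ 1` from the kernel error, so their
  -- product serves both terms.
  refine ⟨10 * C, by linarith, fun N k hk hkN s hs => ?_⟩
  obtain ⟨n, rfl⟩ : ∃ n, k = n + 1 := ⟨k - 1, by omega⟩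
  have hN : (0 : ℝ) < N := by exact_mod_cast (by omega : 0 < N)
  have hc : 0 < (N : ℝ) * ρ := mul_pos hN hρ
  refine (abs_expectedCluster_sub_le hVmeas hV hkN hc (hδ N) hs
    (fun t ht => hCb N (n + 1) (by omega) hkN t ht)).trans ?_
  have hlen : 0 ≤ 1 / windowLength ρ a δ N := one_div_nonneg.2 measureReal_nonneg
  rw [Nat.add_sub_cancel]
  refine add_le_add ?_ ?_
  · calc _ = 1 / (n.factorial : ℝ) * s ^ (n + 1) * (1 / windowLength ρ a δ N) * 10 ^ (n + 1) *
          ((n + 1 : ℕ) : ℝ) ^ (((n + 1 : ℕ) : ℝ) / 2) := by ring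
      _ ≤ _ := by
        gcongr
        linarith
  · have hf : (n.factorial : ℝ) ≠ 0 := by positivity
    calc _ = s ^ n * C ^ (n + 1) * |κ N| := by field_simp
      _ ≤ _ := by
        gcongr
        linarith

/-! ### Bonferroni inequalities -/

/-- With both ends fixed, an increasing tuple amounts to the `n`-element set of its inner values in
the open interval between `p` and `q`. -/
theorem card_strictMono_with_endpoints {N : ℕ} (n : ℕ) {p q : Fin N} (hpq : p < q)
    [DecidablePred fun i : Fin (n + 2) → Fin N => StrictMono i] :
    (((Finset.univ : Finset (Fin (n + 2) → Fin N)).filter (fun i => StrictMono i)).filter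
      (fun i => (i 0, i (Fin.last (n + 1))) = (p, q))).card = ((q : ℕ) - p - 1).choose n := by
  classical
  rw [← Fin.card_Ioo, ← Finset.card_powersetCard]
  symm
  refine Finset.card_bij (fun S hS => Fin.cons p (Fin.snoc
    (S.orderEmbOfFin (Finset.mem_powersetCard.1 hS).2) q : Fin (n + 1) → Fin N)) ?_ ?_ ?_
  · intro S hS
    obtain ⟨hsub, hcard⟩ := Finset.mem_powersetCard.1 hS
    have hmem : ∀ j, p < S.orderEmbOfFin hcard j ∧ S.orderEmbOfFin hcard j < q := fun j =>
      Finset.mem_Ioo.1 (hsub (Finset.orderEmbOfFin_mem S hcard j))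
    simp only [Finset.mem_filter, Finset.mem_univ, true_and]
    constructor
    · intro i j hij
      cases j using Fin.cases with
      | zero => exact absurd hij (by simp)
      | succ j =>
        cases i using Fin.cases with
        | zero =>
          cases j using Fin.lastCases with
          | last => simpa using hpq
          | cast j => simpa using (hmem j).1
        | succ i =>
          have hij' := Fin.succ_lt_succ_iff.1 hij
          cases i using Fin.lastCases with
          | last => exact absurd hij' (not_lt.2 (Fin.le_last j))
          | cast i =>
            cases j using Fin.lastCases with
            | last => simpa using (hmem i).2
            | cast j => simpa using Fin.castSucc_lt_castSucc_iff.1 hij'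
    · rw [← Fin.succ_last]
      simp
  · intro S hS S' hS' h
    have h1 : ∀ j, S.orderEmbOfFin (Finset.mem_powersetCard.1 hS).2 j =
        S'.orderEmbOfFin (Finset.mem_powersetCard.1 hS').2 j := fun j => by
      simpa using congrFun h j.castSucc.succ
    have h2 := Finset.range_orderEmbOfFin S (Finset.mem_powersetCard.1 hS).2
    have h3 := Finset.range_orderEmbOfFin S' (Finset.mem_powersetCard.1 hS').2
    rw [← Finset.coe_inj, ← h2, ← h3]
    exact congrArg Set.range (funext h1)
  · intro i hi
    simp only [Finset.mem_filter, Finset.mem_univ, true_and, Prod.mk.injEq] at hi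
    obtain ⟨hmono, h0, hl⟩ := hi
    have hg : StrictMono fun j : Fin n => i j.castSucc.succ := fun a b hab =>
      hmono (Fin.succ_lt_succ_iff.2 (Fin.castSucc_lt_castSucc_iff.2 hab))
    have hS : (Finset.univ.image fun j : Fin n => i j.castSucc.succ) ∈
        Finset.powersetCard n (Finset.Ioo p q) := by
      refine Finset.mem_powersetCard.2 ⟨?_, ?_⟩
      · intro r hr
        obtain ⟨j, -, rfl⟩ := Finset.mem_image.1 hr
        rw [Finset.mem_Ioo, ← h0, ← hl]
        exact ⟨hmono (Fin.succ_pos _), hmono (by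
          rw [← Fin.succ_last]
          exact Fin.succ_lt_succ_iff.2 (Fin.castSucc_lt_last j))⟩
      · rw [Finset.card_image_of_injective _ hg.injective, Finset.card_univ, Fintype.card_fin]
    refine ⟨_, hS, ?_⟩
    have huniq := Finset.orderEmbOfFin_unique (Finset.mem_powersetCard.1 hS).2
      (fun j => Finset.mem_image_of_mem _ (Finset.mem_univ j)) hg
    funext j
    cases j using Fin.cases with
    | zero => simpa using h0.symm
    | succ j =>
      cases j using Fin.lastCases with
      | last => simpa using hl.symm
      | cast j =>
        have := congrFun huniq j
        simp only [Fin.cons_succ, Fin.snoc_castSucc]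
        exact this.symm

/-- For `d ≥ 1` the partial sum up to index `m` equals `(-1)^m (d-1).choose m`, so its sign is that
of its last term. An even number of terms ends at an odd index, with a negative sign. -/
theorem alternating_sum_choose_le {m : ℕ} (hm : Even m) (d : ℕ) :
    ∑ n ∈ Finset.range m, (-1 : ℝ) ^ n * d.choose n ≤ if d = 0 then 1 else 0 := by
  rcases m with _ | m
  · simp
    split_ifs <;> norm_num
  rcases d with _ | d
  · rw [Finset.sum_range_succ']
    simp
  · have h := Int.alternating_sum_range_choose_eq_choose (n := d) (m := m)
    have h' : ∑ n ∈ Finset.range (m + 1), (-1 : ℝ) ^ n * (d + 1).choose n =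
        (-1) ^ m * d.choose m := by exact_mod_cast h
    have hodd : Odd m := by
      rw [← Nat.not_even_iff_odd]
      exact fun h => (Nat.even_add_one.1 hm) h
    rw [h', hodd.neg_one_pow]
    simp

theorem le_alternating_sum_choose {m : ℕ} (hm : Odd m) (d : ℕ) :
    (if d = 0 then 1 else 0) ≤ ∑ n ∈ Finset.range m, (-1 : ℝ) ^ n * d.choose n := by
  rcases m with _ | m
  · simp at hm
  rcases d with _ | d
  · rw [Finset.sum_range_succ']
    simp
  · have h := Int.alternating_sum_range_choose_eq_choose (n := d) (m := m)
    have h' : ∑ n ∈ Finset.range (m + 1), (-1 : ℝ) ^ n * (d + 1).choose n =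
        (-1) ^ m * d.choose m := by exact_mod_cast h
    have heven : Even m := by
      rw [← Nat.not_odd_iff_even]
      exact fun h => (Nat.odd_add_one.1 hm) h
    rw [h', heven.neg_one_pow]
    simp

section Counting

variable {ρ a : ℝ} {δ : ℕ → ℝ} {N : ℕ}

/-- Configurations for which the points number `p` and `q` lie in the window, in this order and at
rescaled distance at most `s`. -/
def pairRegion (ρ a : ℝ) (δ : ℕ → ℝ) (N : ℕ) (s : ℝ) (pq : Fin N × Fin N) : Set (Fin N → ℝ) :=
  {x | (x pq.1 ∈ window a δ N ∧ x pq.2 ∈ window a δ N) ∧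
    rescale ρ a N (x pq.2) - rescale ρ a N (x pq.1) ∈ Set.Icc 0 s}

theorem measurableSet_pairRegion (s : ℝ) (pq : Fin N × Fin N) :
    MeasurableSet (pairRegion ρ a δ N s pq) := by
  have hap : ∀ i : Fin N, Measurable fun t : Fin N → ℝ => t i := measurable_pi_apply
  have hr : Measurable (rescale ρ a N) := by unfold rescale; fun_prop
  exact ((hap pq.1 measurableSet_Icc).inter (hap pq.2 measurableSet_Icc)).inter
    (((hr.comp (hap _)).sub (hr.comp (hap _))) measurableSet_Icc)

theorem spacingMeasure_real_eq (s : ℝ) (x : Fin N → ℝ) :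
    (spacingMeasure ρ a δ N x).real (Set.Icc 0 s) = 1 / windowLength ρ a δ N *
      ∑ pq : Fin N × Fin N, (if (pq.2 : ℕ) = pq.1 + 1 then 1 else 0) *
        (pairRegion ρ a δ N s pq).indicator (fun _ => (1 : ℝ)) x := by
  classical
  have hL : 0 ≤ 1 / windowLength ρ a δ N := one_div_nonneg.2 measureReal_nonneg
  rw [spacingMeasure, measureReal_def, Measure.smul_apply, Measure.finsetSum_apply, smul_eq_mul,
    ENNReal.toReal_mul, ENNReal.toReal_ofReal hL, ENNReal.toReal_sum (by
      intro i _
      exact measure_ne_top _ _), Finset.sum_filter]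
  congr 1
  refine Finset.sum_congr rfl fun pq _ => ?_
  rw [Measure.dirac_apply' _ measurableSet_Icc]
  by_cases h1 : (pq.2 : ℕ) = pq.1 + 1 <;> by_cases h2 : x pq.1 ∈ window a δ N <;>
    by_cases h3 : x pq.2 ∈ window a δ N <;>
    by_cases h4 : rescale ρ a N (x pq.2) - rescale ρ a N (x pq.1) ∈ Set.Icc 0 s <;>
    simp only [pairRegion, Set.indicator_apply, Set.mem_ofPred_eq, h1, h2, h3, h4] <;> simp

/-- The contribution of a tuple depends only on its first and last index, so the tuples are grouped
by these two. -/
theorem clusterMeasure_real_eq_sum_pairs (hc : 0 < (N : ℝ) * ρ) (n : ℕ) (s : ℝ)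
    (x : Fin N → ℝ) :
    (clusterMeasure ρ a δ N (n + 2) x).real (Set.Icc 0 s) = 1 / windowLength ρ a δ N *
      ∑ pq : Fin N × Fin N,
        (if pq.1 < pq.2 then (((pq.2 : ℕ) - pq.1 - 1).choose n : ℝ) else 0) *
        (pairRegion ρ a δ N s pq).indicator (fun _ => (1 : ℝ)) x := by
  classical
  have hL : 0 ≤ 1 / windowLength ρ a δ N := one_div_nonneg.2 measureReal_nonneg
  rw [clusterMeasure, measureReal_def, Measure.smul_apply, Measure.finsetSum_apply, smul_eq_mul,
    ENNReal.toReal_mul, ENNReal.toReal_ofReal hL, ENNReal.toReal_sum (by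
      intro i _
      exact measure_ne_top _ _)]
  congr 1
  have h1 : ∑ i ∈ (Finset.univ : Finset (Fin (n + 2) → Fin N)).filter (fun i => StrictMono i),
      (pairRegion ρ a δ N s (i 0, i (Fin.last (n + 1)))).indicator (fun _ => (1 : ℝ)) x =
      ∑ pq : Fin N × Fin N,
        (if pq.1 < pq.2 then (((pq.2 : ℕ) - pq.1 - 1).choose n : ℝ) else 0) *
        (pairRegion ρ a δ N s pq).indicator (fun _ => (1 : ℝ)) x := by
    rw [← Finset.sum_fiberwise' _ (fun i : Fin (n + 2) → Fin N => (i 0, i (Fin.last (n + 1))))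
      fun pq => (pairRegion ρ a δ N s pq).indicator (fun _ => (1 : ℝ)) x]
    refine Finset.sum_congr rfl fun pq _ => ?_
    rw [Finset.sum_const, nsmul_eq_mul]
    congr 1
    split_ifs with hlt
    · rw [card_strictMono_with_endpoints n hlt]
    · rw [Nat.cast_eq_zero, Finset.card_eq_zero, Finset.filter_eq_empty_iff]
      intro i hi heq
      have hi' : StrictMono i := (Finset.mem_filter.1 hi).2
      apply hlt
      rw [← heq]
      exact hi' (Fin.last_pos)
  rw [← h1, Finset.sum_filter, Finset.sum_filter]
  refine Finset.sum_congr rfl fun i _ => ?_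
  rw [Measure.dirac_apply' _ measurableSet_Icc]
  simp only [mem_window_iff hc]
  by_cases h1 : StrictMono i <;> by_cases h2 : x (i 0) ∈ window a δ N <;>
    by_cases h3 : x (i (Fin.last (n + 1))) ∈ window a δ N <;>
    by_cases h4 : rescale ρ a N (x (i (Fin.last (n + 1)))) - rescale ρ a N (x (i 0)) ∈
      Set.Icc 0 s <;>
    simp only [pairRegion, Set.indicator_apply, Set.mem_ofPred_eq, h1, h2, h3, h4] <;> simp

theorem alternating_sum_clusterMeasure_real (hc : 0 < (N : ℝ) * ρ) (m : ℕ) (s : ℝ)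
    (x : Fin N → ℝ) :
    ∑ n ∈ Finset.range m, (-1 : ℝ) ^ n * (clusterMeasure ρ a δ N (n + 2) x).real (Set.Icc 0 s) =
      1 / windowLength ρ a δ N * ∑ pq : Fin N × Fin N,
        (if pq.1 < pq.2 then
          ∑ n ∈ Finset.range m, (-1 : ℝ) ^ n * ((pq.2 : ℕ) - pq.1 - 1).choose n else 0) *
        (pairRegion ρ a δ N s pq).indicator (fun _ => (1 : ℝ)) x := by
  simp only [clusterMeasure_real_eq_sum_pairs hc, Finset.mul_sum]
  rw [Finset.sum_comm]
  refine Finset.sum_congr rfl fun pq _ => ?_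
  split_ifs
  · rw [Finset.sum_mul, Finset.mul_sum]
    refine Finset.sum_congr rfl fun n _ => ?_
    ring
  · simp

/-- Neighbours are the pairs with no index in between. The guard `p < q` is essential, since
truncated subtraction also gives 0 for `q ≤ p`. -/
theorem adjacent_iff (p q : Fin N) :
    (if (q : ℕ) = p + 1 then (1 : ℝ) else 0) =
      if p < q then (if (q : ℕ) - p - 1 = 0 then 1 else 0) else 0 := by
  simp only [Fin.lt_def]
  split_ifs <;> first | rfl | omega

theorem alternating_sum_clusterMeasure_le (hc : 0 < (N : ℝ) * ρ) {m : ℕ} (hm : Even m) (s : ℝ)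
    (x : Fin N → ℝ) :
    ∑ n ∈ Finset.range m, (-1 : ℝ) ^ n * (clusterMeasure ρ a δ N (n + 2) x).real (Set.Icc 0 s) ≤
      (spacingMeasure ρ a δ N x).real (Set.Icc 0 s) := by
  rw [alternating_sum_clusterMeasure_real hc, spacingMeasure_real_eq]
  refine mul_le_mul_of_nonneg_left (Finset.sum_le_sum fun pq _ => ?_)
    (one_div_nonneg.2 measureReal_nonneg)
  refine mul_le_mul_of_nonneg_right ?_ (Set.indicator_nonneg (fun _ _ => zero_le_one) x)
  rw [adjacent_iff]
  split_ifs with h1 h2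
  · simpa [h2] using alternating_sum_choose_le hm ((pq.2 : ℕ) - pq.1 - 1)
  · simpa [h2] using alternating_sum_choose_le hm ((pq.2 : ℕ) - pq.1 - 1)
  · exact le_rfl

theorem le_alternating_sum_clusterMeasure (hc : 0 < (N : ℝ) * ρ) {m : ℕ} (hm : Odd m) (s : ℝ)
    (x : Fin N → ℝ) :
    (spacingMeasure ρ a δ N x).real (Set.Icc 0 s) ≤
    ∑ n ∈ Finset.range m, (-1 : ℝ) ^ n *
      (clusterMeasure ρ a δ N (n + 2) x).real (Set.Icc 0 s) := by
  rw [alternating_sum_clusterMeasure_real hc, spacingMeasure_real_eq]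
  refine mul_le_mul_of_nonneg_left (Finset.sum_le_sum fun pq _ => ?_)
    (one_div_nonneg.2 measureReal_nonneg)
  refine mul_le_mul_of_nonneg_right ?_ (Set.indicator_nonneg (fun _ _ => zero_le_one) x)
  rw [adjacent_iff]
  split_ifs with h1 h2
  · simpa [h2] using le_alternating_sum_choose hm ((pq.2 : ℕ) - pq.1 - 1)
  · simpa [h2] using le_alternating_sum_choose hm ((pq.2 : ℕ) - pq.1 - 1)
  · exact le_rfl

variable {β : DysonIndex} {V : ℝ → ℝ}

theorem integrable_spacingMeasure_real (hVmeas : Measurable V) (hV : HasFiniteMoments V)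
    (hN : 1 ≤ N) (s : ℝ) :
    Integrable (fun x => (spacingMeasure ρ a δ N x).real (Set.Icc 0 s)) (eigenvalueLaw β V N) := by
  have := isFiniteMeasure_eigenvalueLaw β hVmeas hV hN
  simp only [spacingMeasure_real_eq]
  exact (integrable_finsetSum _ fun pq _ =>
    ((integrable_const (1 : ℝ)).indicator (measurableSet_pairRegion s pq)).const_mul _).const_mul _

theorem integrable_clusterMeasure_real (hVmeas : Measurable V) (hV : HasFiniteMoments V)
    (hN : 1 ≤ N) (hc : 0 < (N : ℝ) * ρ) (n : ℕ) (s : ℝ) :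
    Integrable (fun x => (clusterMeasure ρ a δ N (n + 2) x).real (Set.Icc 0 s))
      (eigenvalueLaw β V N) := by
  have := isFiniteMeasure_eigenvalueLaw β hVmeas hV hN
  simp only [clusterMeasure_real_eq_sum_pairs hc]
  exact (integrable_finsetSum _ fun pq _ =>
    ((integrable_const (1 : ℝ)).indicator (measurableSet_pairRegion s pq)).const_mul _).const_mul _

theorem alternating_sum_expectedCluster (hVmeas : Measurable V) (hV : HasFiniteMoments V)
    (hN : 1 ≤ N) (hc : 0 < (N : ℝ) * ρ) (m : ℕ) (s : ℝ) :
    ∑ n ∈ Finset.range m, (-1 : ℝ) ^ n * expectedCluster β V ρ a δ N (n + 2) s =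
      ∫ x, ∑ n ∈ Finset.range m, (-1 : ℝ) ^ n *
        (clusterMeasure ρ a δ N (n + 2) x).real (Set.Icc 0 s) ∂(eigenvalueLaw β V N) := by
  rw [integral_finsetSum _ fun n _ =>
    (integrable_clusterMeasure_real hVmeas hV hN hc n s).const_mul _]
  simp only [integral_const_mul, expectedCluster]

theorem alternating_sum_expectedCluster_le (hVmeas : Measurable V) (hV : HasFiniteMoments V)
    (hN : 1 ≤ N) (hc : 0 < (N : ℝ) * ρ) {m : ℕ} (hm : Even m) (s : ℝ) :
    ∑ n ∈ Finset.range m, (-1 : ℝ) ^ n * expectedCluster β V ρ a δ N (n + 2) s ≤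
      expectedSpacing β V ρ a δ N s := by
  rw [alternating_sum_expectedCluster hVmeas hV hN hc]
  exact integral_mono (integrable_finsetSum _ fun n _ =>
    (integrable_clusterMeasure_real hVmeas hV hN hc n s).const_mul _)
    (integrable_spacingMeasure_real hVmeas hV hN s)
    fun x => alternating_sum_clusterMeasure_le hc hm s x

theorem le_alternating_sum_expectedCluster (hVmeas : Measurable V) (hV : HasFiniteMoments V)
    (hN : 1 ≤ N) (hc : 0 < (N : ℝ) * ρ) {m : ℕ} (hm : Odd m) (s : ℝ) :
    expectedSpacing β V ρ a δ N s ≤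
      ∑ n ∈ Finset.range m, (-1 : ℝ) ^ n * expectedCluster β V ρ a δ N (n + 2) s := by
  rw [alternating_sum_expectedCluster hVmeas hV hN hc]
  exact integral_mono (integrable_spacingMeasure_real hVmeas hV hN s)
    (integrable_finsetSum _ fun n _ =>
      (integrable_clusterMeasure_real hVmeas hV hN hc n s).const_mul _)
    fun x => le_alternating_sum_clusterMeasure hc hm s x

end Counting

/-! ### The limits -/

section Limits

variable {β : DysonIndex} {V : ℝ → ℝ} {ρ a : ℝ} {δ κ : ℕ → ℝ}

theorem tendsto_mul_window (hρ : 0 < ρ)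
    (hδN : Tendsto (fun N : ℕ => (N : ℝ) * δ N) atTop atTop) :
    Tendsto (fun N : ℕ => N * ρ * δ N) atTop atTop := by
  have : (fun N : ℕ => N * ρ * δ N) = fun N : ℕ => ρ * (N * δ N) := by
    funext N
    ring
  rw [this]
  exact hδN.const_mul_atTop hρ

theorem tendsto_rescaledCorrelation (hρ : 0 < ρ)
    (hδN : Tendsto (fun N : ℕ => (N : ℝ) * δ N) atTop atTop) (hκ : Tendsto κ atTop (𝓝 0))
    (hK : KernelsConverge β V ρ a δ κ) {k : ℕ} (hk : 1 ≤ k) (t : Fin k → ℝ) :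
    Tendsto (fun N : ℕ => rescaledCorrelation β V ρ a N k t) atTop
      (𝓝 (limitCorrelation β k t)) := by
  obtain ⟨C, -, hC⟩ := exists_abs_rescaledCorrelation_sub_le hκ hK
  rw [tendsto_iff_dist_tendsto_zero]
  have hlim : Tendsto (fun N => C ^ k * (k - 1).factorial * |κ N|) atTop (𝓝 0) := by
    simpa using (hκ.abs).const_mul (C ^ k * ((k - 1).factorial : ℝ))
  refine squeeze_zero' (Filter.Eventually.of_forall fun _ => dist_nonneg) ?_ hlim
  -- A fixed tuple eventually lies in the windows, because they exhaust the line.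
  have hwin : ∀ i, ∀ᶠ N : ℕ in atTop, |t i| ≤ N * ρ * δ N := fun i =>
    (tendsto_mul_window hρ hδN).eventually_ge_atTop _
  filter_upwards [eventually_ge_atTop k, eventually_all.2 hwin] with N hN hw
  have hc : 0 < (N : ℝ) * ρ := mul_pos (by exact_mod_cast (by omega : 0 < N)) hρ
  refine hC N k hk hN t fun i => ?_
  rw [rescaledWindow_eq hc]
  exact abs_le.1 (hw i)

theorem tendsto_expectedCluster (hVmeas : Measurable V) (hV : HasFiniteMoments V) (hρ : 0 < ρ)
    (hδ : ∀ N, 0 < δ N) (hδN : Tendsto (fun N : ℕ => (N : ℝ) * δ N) atTop atTop)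
    (hκ : Tendsto κ atTop (𝓝 0)) (hK : KernelsConverge β V ρ a δ κ) {k : ℕ} (hk : 2 ≤ k) {s : ℝ}
    (hs : 0 ≤ s) :
    Tendsto (fun N : ℕ => expectedCluster β V ρ a δ N k s) atTop (𝓝 (orderedIntegral β k s)) := by
  obtain ⟨C, -, hC⟩ := exists_abs_expectedCluster_sub_orderedIntegral_le hVmeas hV hρ hδ hκ hK
  rw [tendsto_iff_dist_tendsto_zero]
  have hlen : Tendsto (fun N => 1 / windowLength ρ a δ N) atTop (𝓝 0) := by
    have h2 : Tendsto (fun N : ℕ => 1 / (2 * (N * ρ * δ N))) atTop (𝓝 0) := by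
      simpa only [one_div, Pi.inv_def] using
        ((tendsto_mul_window hρ hδN).const_mul_atTop (zero_lt_two' ℝ)).inv_tendsto_atTop
    refine h2.congr' ?_
    filter_upwards [eventually_ge_atTop 1] with N hN
    rw [windowLength_eq (mul_pos (by exact_mod_cast (by omega : 0 < N)) hρ) (hδ N)]
  have hlim : Tendsto (fun N => 1 / ((k - 1).factorial : ℝ) * s ^ k * (1 / windowLength ρ a δ N) *
      C ^ k * (k : ℝ) ^ ((k : ℝ) / 2) + s ^ (k - 1) * C ^ k * |κ N|) atTop (𝓝 0) := by
    simpa using (((hlen.const_mul (1 / ((k - 1).factorial : ℝ) * s ^ k)).mul_const (C ^ k)).mul_const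
      ((k : ℝ) ^ ((k : ℝ) / 2))).add ((hκ.abs).const_mul (s ^ (k - 1) * C ^ k))
  refine squeeze_zero' (Filter.Eventually.of_forall fun _ => dist_nonneg) ?_ hlim
  filter_upwards [eventually_ge_atTop k] with N hN
  exact hC N k hk hN s hs

/-- Since `k^k` is at most `6^k (k-1)!`, the terms decay like `C^k s^(k-1) / √((k-1)!)`. The root is
avoided by writing the bound as a product of `(1/2)^k` and a second factor and using `xy ≤ x² + y²`:
the squares form a geometric and an exponential series. -/
theorem summable_orderedIntegral (β : DysonIndex) {s : ℝ} (hs : 0 ≤ s) :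
    Summable fun n : ℕ => (-1 : ℝ) ^ (n + 2) * orderedIntegral β (n + 2) s := by
  have h1 : Summable fun n : ℕ => (1 / 4 : ℝ) ^ n :=
    summable_geometric_of_lt_one (by norm_num) (by norm_num)
  have h2 : Summable fun n : ℕ => (2400 * s ^ 2) ^ (n + 1) / ((n + 1).factorial : ℝ) :=
    (summable_nat_add_iff 1).2 (Real.summable_pow_div_factorial (2400 * s ^ 2))
  refine Summable.of_norm_bounded (h1.add (h2.mul_left 2400)) fun n => ?_
  rw [norm_mul, norm_pow, norm_neg, norm_one, one_pow, one_mul, Real.norm_eq_abs]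
  refine (abs_orderedIntegral_le β (n + 1) hs).trans ?_
  set k := n + 1 + 1 with hk
  set r := (k : ℝ) ^ ((k : ℝ) / 2) with hr
  have hr0 : 0 ≤ r := by positivity
  have hfpos : (0 : ℝ) < (n + 1).factorial := by positivity
  have hr2 : r ^ 2 = (k : ℝ) ^ k := by
    rw [hr, ← Real.rpow_mul_natCast (Nat.cast_nonneg k), ← Real.rpow_natCast]
    congr 1
    push_cast
    ring
  -- The base 6 is `3 * 2`, from `k^k ≤ e^k k!` with `e < 3` and from `k ≤ 2^k`. Together with `20²`
  -- it yields 2400 below.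
  have hkk : (k : ℝ) ^ k ≤ 6 ^ k * (n + 1).factorial := by
    have h3 := Real.pow_div_factorial_le_exp (x := (k : ℝ)) (Nat.cast_nonneg k) k
    rw [div_le_iff₀ (by positivity)] at h3
    have h4 : Real.exp k ≤ 3 ^ k := by
      rw [← Real.exp_one_pow]
      exact pow_le_pow_left₀ (Real.exp_pos 1).le (Real.exp_one_lt_d9.le.trans (by norm_num)) k
    have h5 : (k.factorial : ℝ) ≤ 2 ^ k * (n + 1).factorial := by
      rw [hk, Nat.factorial_succ]
      push_cast
      refine mul_le_mul_of_nonneg_right ?_ hfpos.le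
      have : n + 1 + 1 ≤ 2 ^ (n + 1 + 1) := Nat.lt_two_pow_self.le
      exact_mod_cast this
    calc (k : ℝ) ^ k ≤ Real.exp k * k.factorial := h3
      _ ≤ 3 ^ k * (2 ^ k * (n + 1).factorial) := by gcongr
      _ = _ := by rw [← mul_assoc, ← mul_pow]; norm_num
  set y := s ^ (n + 1) / ((n + 1).factorial : ℝ) with hy
  have hsq : (20 ^ k * r * y) ^ 2 ≤ 2400 * ((2400 * s ^ 2) ^ (n + 1) / ((n + 1).factorial : ℝ)) := by
    calc (20 ^ k * r * y) ^ 2 = (400 ^ k * (k : ℝ) ^ k) * y ^ 2 := by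
          rw [mul_pow, mul_pow, hr2, ← pow_mul, mul_comm k 2, pow_mul]
          norm_num
      _ ≤ (400 ^ k * (6 ^ k * (n + 1).factorial)) * y ^ 2 := by gcongr
      _ = 2400 ^ k * (n + 1).factorial * y ^ 2 := by
          rw [← mul_assoc, ← mul_pow]; norm_num
      _ = _ := by
          rw [hy, hk, pow_succ (2400 : ℝ) (n + 1), mul_pow, div_pow]
          field_simp
          ring
  have hquarter : ((1 / 2 : ℝ) ^ k) ^ 2 ≤ (1 / 4) ^ n := by
    rw [← pow_mul, mul_comm k 2, pow_mul]
    norm_num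
    exact pow_le_pow_of_le_one (by norm_num) (by norm_num) (by omega)
  have hprod : 10 ^ k * r * y = (1 / 2) ^ k * (20 ^ k * r * y) := by
    have : (10 : ℝ) ^ k = (1 / 2) ^ k * 20 ^ k := by rw [← mul_pow]; norm_num
    rw [this]
    ring
  rw [hprod]
  nlinarith [two_mul_le_add_sq ((1 / 2 : ℝ) ^ k) (20 ^ k * r * y),
    sq_nonneg ((1 / 2 : ℝ) ^ k), sq_nonneg (20 ^ k * r * y)]

/-- Below a given number smaller than the limit, an even truncation of the series still exceeds it;
for that fixed truncation the finitely many cluster expectations converge, and Bonferroni gives the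
lower bound for large `N`. Odd truncations give the upper bound. No uniformity in the truncation is
needed. -/
theorem tendsto_expectedSpacing (hVmeas : Measurable V) (hV : HasFiniteMoments V) (hρ : 0 < ρ)
    (hδ : ∀ N, 0 < δ N) (hδN : Tendsto (fun N : ℕ => (N : ℝ) * δ N) atTop atTop)
    (hκ : Tendsto κ atTop (𝓝 0)) (hK : KernelsConverge β V ρ a δ κ) {s : ℝ} (hs : 0 ≤ s) :
    Tendsto (fun N : ℕ => expectedSpacing β V ρ a δ N s) atTop
      (𝓝 (∑' n : ℕ, (-1 : ℝ) ^ (n + 2) * orderedIntegral β (n + 2) s)) := by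
  have hsign : ∀ n : ℕ, (-1 : ℝ) ^ (n + 2) = (-1) ^ n := fun n => by rw [pow_add]; norm_num
  have hsum := (summable_orderedIntegral β hs).hasSum.tendsto_sum_nat
  have hpart : ∀ m : ℕ, Tendsto (fun N : ℕ => ∑ n ∈ Finset.range m,
      (-1 : ℝ) ^ n * expectedCluster β V ρ a δ N (n + 2) s) atTop
      (𝓝 (∑ n ∈ Finset.range m, (-1 : ℝ) ^ (n + 2) * orderedIntegral β (n + 2) s)) := by
    intro m
    simp only [hsign]
    exact tendsto_finsetSum _ fun n _ =>
      (tendsto_expectedCluster hVmeas hV hρ hδ hδN hκ hK (by omega) hs).const_mul _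
  have hpos : ∀ N : ℕ, 1 ≤ N → 0 < (N : ℝ) * ρ := fun N hN =>
    mul_pos (by exact_mod_cast hN) hρ
  refine tendsto_order.2 ⟨fun b hb => ?_, fun b hb => ?_⟩
  · obtain ⟨m, hm, hme⟩ := ((hsum.eventually (lt_mem_nhds hb)).and_frequently
      (Nat.frequently_even)).exists
    filter_upwards [(hpart m).eventually (lt_mem_nhds hm), eventually_ge_atTop 1] with N hN hN1
    exact hN.trans_le (alternating_sum_expectedCluster_le hVmeas hV hN1 (hpos N hN1) hme s)
  · obtain ⟨m, hm, hmo⟩ := ((hsum.eventually (gt_mem_nhds hb)).and_frequently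
      (Nat.frequently_odd)).exists
    filter_upwards [(hpart m).eventually (gt_mem_nhds hm), eventually_ge_atTop 1] with N hN hN1
    exact (le_alternating_sum_expectedCluster hVmeas hV hN1 (hpos N hN1) hmo s).trans_lt hN

end Limits

/-! ### Conclusion -/

theorem theorem4p2
    (β : DysonIndex) (V : ℝ → ℝ) (hVmeas : Measurable V) (hV : HasFiniteMoments V)
    (ψ : ℝ → ℝ) (hψ : IsLimitingSpectralDensity β V ψ)
    (a : ℝ) (hacont : ContinuousAt ψ a) (hasupp : a ∈ interior (tsupport ψ)) (hapos : 0 < ψ a)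
    (δ : ℕ → ℝ) (hδpos : ∀ N, 0 < δ N) (hδ : Tendsto δ atTop (𝓝 0))
    (hδN : Tendsto (fun N : ℕ => (N : ℝ) * δ N) atTop atTop)
    (κ : ℕ → ℝ) (hκ : Tendsto κ atTop (𝓝 0))
    (hK : KernelsConverge β V (ψ a) a δ κ) :
    -- the functions `W_k` are the limits of the rescaled correlation functions
    (∀ k : ℕ, 1 ≤ k → ∀ t : Fin k → ℝ,
      Tendsto (fun N : ℕ => rescaledCorrelation β V (ψ a) a N k t) atTop
        (𝓝 (limitCorrelation β k t))) ∧
    -- (i)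
    (∃ C : ℝ, 0 < C ∧ ∀ N k : ℕ, 2 ≤ k → k ≤ N → ∀ s : ℝ, 0 ≤ s →
      |expectedCluster β V (ψ a) a δ N k s - orderedIntegral β k s| ≤
        1 / ((k - 1).factorial : ℝ) * s ^ k * (1 / windowLength (ψ a) a δ N) * C ^ k
            * (k : ℝ) ^ ((k : ℝ) / 2)
          + s ^ (k - 1) * C ^ k * |κ N|) ∧
    -- (ii)
    (∀ s : ℝ, 0 ≤ s →
      Summable (fun n : ℕ => (-1 : ℝ) ^ (n + 2) * orderedIntegral β (n + 2) s) ∧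
      Tendsto (fun N : ℕ => expectedSpacing β V (ψ a) a δ N s) atTop
        (𝓝 (∑' n : ℕ, (-1 : ℝ) ^ (n + 2) * orderedIntegral β (n + 2) s))) := by
  exact ⟨fun k hk t => tendsto_rescaledCorrelation hapos hδN hκ hK hk t,
    exists_abs_expectedCluster_sub_orderedIntegral_le hVmeas hV hapos hδpos hκ hK,
    fun s hs => ⟨summable_orderedIntegral β hs,
      tendsto_expectedSpacing hVmeas hV hapos hδpos hδN hκ hK hs⟩⟩
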